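/- **Theorem (functional equations of the Herglotz-Zagier-Novikov function).** Let $\mathbb{D}'=\{z\in\mathbb{C}: 0<|z|\le 1,\ z\ne 1\}$, $\mathbb{D}_1'=\{z\in\mathbb{C}: |z|=1,\ z\neq 1\}$ and $\mathbb{C}'=\mathbb{C}\setminus(-\infty,0]$. All logarithms and square roots are principal, and $\mathrm{Li}_2(z)=-\int_0^1\frac{\log(1-zt)}{t}\,dt$ is the principal branch of the dilogarithm on $\mathbb{C}\setminus[1,\infty)$. For $u,v\in\mathbb{D}'$ put $$\mathscr{F}(x;u,v)=\int_0^1\frac{\log(1-ut^x)}{v^{-1}-t}\,dt\qquad(\mathrm{Re}(x)>0).$$ This integral converges, and it extends analytically in $x$ to $\mathbb{C}'$; the extension is again denoted by $\mathscr{F}(x;u,v)$. If $|u|<1$ and $|v|<1$, then $$\mathscr{F}(x;u,v)=-\sum_{m,n\ge1}\frac{u^mv^n}{m(mx+n)}\qquad(x\in\mathbb{C}').$$ For all $x\in\mathbb{C}'$ the following hold. (1) For $u,v\in\mathbb{D}'$, $$\mathscr{F}(x;u,v)+\mathscr{F}\left(\tfrac1x;v,u\right)=-\log(1-u)\log(1-v).$$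 (2) For $u,v,uv\in\mathbb{D}'$, $$\begin{aligned} &\mathscr{F}(x;u,v)-\mathscr{F}(x+1;uv,v)-\mathscr{F}\left(\tfrac{x}{x+1};u,uv\right)\\ &=\log(1-u)\log(1-uv)+\mathrm{Li}_2(u)-\mathrm{Li}_2\left(\tfrac{v}{v-1}\right)+2\,\mathrm{Li}_2\left(\tfrac{u}{u-1}\right)-\mathrm{Li}_2\left(\tfrac{u-v}{1-v}\right)\\ &\quad-\left(\tfrac1{x+1}-\tfrac12\right)\mathrm{Li}_2(uv)-\sum_{j=1}^2\left\{\mathrm{Li}_2\left(\tfrac{u+\sqrt{uv}\,e^{\pi ij}}{u-1}\right)-\mathrm{Li}_2\left(\tfrac{v+\sqrt{uv}\,e^{\pi ij}}{v-1}\right)\right\}. \end{aligned}$$ (3) For $u,v\in\mathbb{D}_1'$ with $uv\ne1$, $$\begin{aligned} &\mathscr{F}(x;u,v)+\mathscr{F}(x;u^{-1},v^{-1})-\mathscr{F}(x+1;uv,v)-\mathscr{F}\left(x+1;(uv)^{-1},v^{-1}\right)\\ &\quad-\mathscr{F}\left(\tfrac{x}{x+1};u,uv\right)-\mathscr{F}\left(\tfrac{x}{x+1};u^{-1},(uv)^{-1}\right)\\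 &=\log(1-u)\log(1-uv)+\log(1-u^{-1})\log\left(1-(uv)^{-1}\right)+2\log\left(\tfrac{u}{u-1}\right)\log(1-u)-\tfrac12\log^2(-u)\\ &\quad-\log\left(\tfrac{v}{v-1}\right)\log(1-v)+\left(\tfrac1{x+1}-\tfrac12\right)\left(\tfrac12\log^2(-uv)+\tfrac{\pi^2}{6}\right)-\mathrm{Li}_2\left(\tfrac{u-v}{1-v}\right)-\mathrm{Li}_2\left(\tfrac{u-v}{u(1-v)}\right)\\ &\quad-\sum_{j=1}^2\left\{\mathrm{Li}_2\left(\tfrac{u+\sqrt{uv}\,e^{\pi ij}}{u-1}\right)-\mathrm{Li}_2\left(\tfrac{v+\sqrt{uv}\,e^{\pi ij}}{v-1}\right)+\mathrm{Li}_2\left(\tfrac{1+\sqrt{uv^{-1}}\,e^{\pi ij}}{1-u}\right)-\mathrm{Li}_2\left(\tfrac{1+\sqrt{vu^{-1}}\,e^{\pi ij}}{1-v}\right)\right\}. \end{aligned}$$ -/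

import Mathlib

namespace HZN

noncomputable section

/-- The principal branch of the dilogarithm on `ℂ ∖ [1, ∞)`,
`Li₂(z) = -∫₀ᶻ log(1 - w) dw / w`, the integral being taken along the segment `w = t z`. It
continues `∑_{n ≥ 1} zⁿ / n²` from the unit disc. -/
def Li2 (z : ℂ) : ℂ :=
  -∫ t in (0 : ℝ)..1, Complex.log (1 - z * (t : ℂ)) / (t : ℂ)

/-- The integrand `log(1 - u tˣ) / (v⁻¹ - t)` of the Herglotz-Zagier-Novikov function. -/
def integrand (x u v : ℂ) (t : ℝ) : ℂ :=
  Complex.log (1 - u * (t : ℂ) ^ x) / (v⁻¹ - (t : ℂ))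

/-- The integral `∫₀¹ log(1 - u tˣ) / (v⁻¹ - t) dt`, which defines the function for `Re x > 0`. -/
def integral (x u v : ℂ) : ℂ :=
  ∫ t in (0 : ℝ)..1, integrand x u v t

/-- `g` is an analytic continuation in `x` of the integral, from the half plane `Re x > 0` to the
slit plane `ℂ ∖ (-∞, 0]`. There is at most one on the slit plane, since that is connected. -/
def IsContinuation (u v : ℂ) (g : ℂ → ℂ) : Prop :=
  DifferentiableOn ℂ g Complex.slitPlane ∧ ∀ x : ℂ, 0 < x.re → g x = integral x u v

open Classical in
/-- The Herglotz-Zagier-Novikov function `𝓕(x; u, v)`: the analytic continuation in `x` of the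
integral to `ℂ ∖ (-∞, 0]` (and only the integral itself for `u, v` without such a continuation). -/
def F (x u v : ℂ) : ℂ :=
  if h : ∃ g : ℂ → ℂ, IsContinuation u v g then h.choose x else integral x u v

/-- The set `𝔻'` of all `z` with `0 < |z| ≤ 1` and `z ≠ 1`. -/
def disk : Set ℂ := {z | z ≠ 0 ∧ ‖z‖ ≤ 1 ∧ z ≠ 1}

/-- The set `𝔻₁'`, the unit circle without the point `1`. -/
def circle : Set ℂ := {z | ‖z‖ = 1 ∧ z ≠ 1}

/-- The principal square root. -/
def csqrt (z : ℂ) : ℂ := z ^ (1 / 2 : ℂ)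

/-- The sign `e^{π i j}`. -/
def expPi (j : ℕ) : ℂ := Complex.exp ((Real.pi : ℂ) * Complex.I * (j : ℂ))

end

end HZN

/-!
With `t = e^{-r}` the integral becomes `∫ log (1 - u e^{-x r}) d log (1 - v e^{-r})` over `r > 0`.
Write `K a b u v` for `∫ log (1 - u e^{-a r}) d log (1 - v e^{-b r})`. It makes sense for
`Re a, Re b > 0`, is holomorphic in `a` and `b` (`differentiableOn_K`), and a substitution
`r ↦ c r` shows that it depends on `a / b` only (`K_smul`). So `K (√x) (1 / √x) u v`, which is
holomorphic on the whole slit plane, continues the integral (`isContinuation_K`). In this form the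
two-term equation is integration by parts (`K_add_K`), and the double series is the product of the
expansions of the two factors, integrated term by term (`hasSum_K`).

For the three-term equation put `p = u e^{-x r}` and `q = v e^{-r}`. By homogeneity the three values
on the left are integrals over the same curve, of `log (1 - p) d log (1 - q)`,
`log (1 - p q) d log (1 - q)` and `log (1 - p) d log (1 - p q)`. Since `p` and `q` are exponentials,
`dp / p = x dq / q`, and the combination of the three forms is exact: minus the right-hand side
of the equation, with `u, v, √(u v)` replaced by `p, q, √(u v) e^{-(x + 1) r / 2}`, is a primitive
(`hasDerivAt_primitive`). It vanishes at `r = ∞` and is continuous up to `r = 0`, also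
for `u, v` on the unit circle, which gives the equation for suitable real `x` (`K_three_term`). The
identity theorem extends it to the slit plane (`F_three_term`).

The six-term equation is the sum of the three-term equations for `(u, v)` and `(u⁻¹, v⁻¹)`,
simplified by the inversion and reflection formulas of the dilogarithm (`Li2_add_Li2_inv`,
`Li2_add_Li2_one_sub`). Both formulas hold up to a constant because the derivatives agree; the
constants come from `Li₂(-1) = -π² / 12`, which is a Fourier series value, and from Landen's identity.
-/

namespace HZN

open Set Filter Topology MeasureTheory Complex

/-! ### Logarithms on the right half plane -/

theorem re_lt_one {w : ℂ} (h : ‖w‖ ≤ 1) (h1 : w ≠ 1) : w.re < 1 := by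
  refine lt_of_le_of_ne ((re_le_norm w).trans h) fun hre => h1 ?_
  have h2 : w.re ^ 2 + w.im ^ 2 ≤ 1 := by
    have := Complex.sq_norm w
    rw [normSq_apply] at this
    nlinarith [norm_nonneg w]
  have h3 : w.im = 0 := by
    rw [hre] at h2
    nlinarith [sq_nonneg w.im]
  exact Complex.ext (by simpa using hre) (by simpa using h3)

theorem one_sub_re_pos {w : ℂ} (h : w.re < 1) : 0 < (1 - w).re := by simpa using h

theorem mem_slitPlane_of_re_pos {z : ℂ} (h : 0 < z.re) : z ∈ slitPlane := Or.inl h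

theorem abs_arg_lt {z : ℂ} (h : 0 < z.re) : |z.arg| < Real.pi / 2 :=
  abs_arg_lt_pi_div_two_iff.2 (Or.inl h)

theorem log_mul_of_re_pos {z w : ℂ} (hz : 0 < z.re) (hw : 0 < w.re) :
    log (z * w) = log z + log w := by
  have h1 := abs_lt.1 (abs_arg_lt hz)
  have h2 := abs_lt.1 (abs_arg_lt hw)
  exact log_mul (ne_zero_of_re_pos hz) (ne_zero_of_re_pos hw) ⟨by linarith, by linarith⟩

theorem inv_re_pos {w : ℂ} (hw : 0 < w.re) : 0 < (w⁻¹).re := by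
  rw [inv_re]
  exact div_pos hw (normSq_pos.2 (ne_zero_of_re_pos hw))

theorem log_inv_of_re_pos {w : ℂ} (hw : 0 < w.re) : log w⁻¹ = -log w := by
  refine log_inv _ fun h => ?_
  have h2 := abs_lt.1 (abs_arg_lt hw)
  linarith [Real.pi_pos]

theorem log_div_of_re_pos {z w : ℂ} (hz : 0 < z.re) (hw : 0 < w.re) :
    log (z / w) = log z - log w := by
  rw [div_eq_mul_inv, log_mul_of_re_pos hz (inv_re_pos hw), log_inv_of_re_pos hw, sub_eq_add_neg]

theorem mul_mem_slitPlane_of_re_pos {z w : ℂ} (hz : 0 < z.re) (hw : 0 < w.re) :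
    z * w ∈ slitPlane := by
  have h1 := abs_lt.1 (abs_arg_lt hz)
  have h2 := abs_lt.1 (abs_arg_lt hw)
  rw [mem_slitPlane_iff_arg]
  refine ⟨?_, mul_ne_zero (ne_zero_of_re_pos hz) (ne_zero_of_re_pos hw)⟩
  rw [arg_mul (ne_zero_of_re_pos hz) (ne_zero_of_re_pos hw) ⟨by linarith, by linarith⟩]
  linarith

theorem div_mem_slitPlane_of_re_pos {z w : ℂ} (hz : 0 < z.re) (hw : 0 < w.re) :
    z / w ∈ slitPlane := by
  rw [div_eq_mul_inv]
  exact mul_mem_slitPlane_of_re_pos hz (inv_re_pos hw)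

/-! ### Holomorphic parameter integrals -/

/-- The integral of a dominated family of holomorphic functions is holomorphic. -/
theorem differentiableOn_integral_of_dominated {α : Type*} [MeasurableSpace α] {μ : Measure α}
    {U : Set ℂ} (hU : IsOpen U) {f : ℂ → α → ℂ}
    (hmeas : ∀ z, AEStronglyMeasurable (f z) μ)
    (hdiff : ∀ᵐ t ∂μ, DifferentiableOn ℂ (fun z => f z t) U)
    (hbound : ∀ z₀ ∈ U, ∃ s ∈ 𝓝 z₀, ∃ B : α → ℝ, Integrable B μ ∧
      ∀ᵐ t ∂μ, ∀ z ∈ s, ‖f z t‖ ≤ B t) :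
    DifferentiableOn ℂ (fun z => ∫ t, f z t ∂μ) U := by
  intro z₀ hz₀
  obtain ⟨s, hs, B, hB, hfB⟩ := hbound z₀ hz₀
  obtain ⟨ε, hε, hball⟩ := Metric.nhds_basis_closedBall.mem_iff.1
    (inter_mem hs (hU.mem_nhds hz₀))
  have hder : ∀ᵐ t ∂μ, ∀ z ∈ U, HasDerivAt (fun z => f z t) (deriv (fun z => f z t) z) z := by
    filter_upwards [hdiff] with t ht z hz
    exact (ht.differentiableAt (hU.mem_nhds hz)).hasDerivAt
  have hmeas' : AEStronglyMeasurable (fun t => deriv (fun z => f z t) z₀) μ := by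
    refine aestronglyMeasurable_of_tendsto_ae atTop
      (f := fun (n : ℕ) t => ((1 / ((n : ℝ) + 1) : ℝ) : ℂ)⁻¹ •
        (f (z₀ + ((1 / ((n : ℝ) + 1) : ℝ) : ℂ)) t - f z₀ t)) ?_ ?_
    · intro n
      exact ((hmeas _).sub (hmeas _)).const_smul (((1 / ((n : ℝ) + 1) : ℝ) : ℂ)⁻¹)
    · filter_upwards [hder] with t ht
      have h1 := (ht z₀ hz₀).tendsto_slope_zero
      refine h1.comp (tendsto_nhdsWithin_iff.2 ⟨?_, ?_⟩)
      · have := (continuous_ofReal.tendsto 0).comp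
          (tendsto_one_div_add_atTop_nhds_zero_nat (𝕜 := ℝ))
        simpa [Function.comp_def] using this
      · refine Eventually.of_forall fun n => ?_
        have : (1 / ((n : ℝ) + 1)) ≠ 0 := by positivity
        exact mem_compl_singleton_iff.2 (ofReal_ne_zero.2 this)
  refine (hasDerivAt_integral_of_dominated_loc_of_deriv_le (F := f)
    (F' := fun z t => deriv (fun z => f z t) z) (bound := fun t => B t / (ε / 2))
    (Metric.ball_mem_nhds z₀ (half_pos hε)) (Eventually.of_forall hmeas) ?_ hmeas' ?_
    (hB.div_const _) ?_).2.differentiableAt.differentiableWithinAt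
  · refine hB.mono' (hmeas _) ?_
    filter_upwards [hfB] with t ht using ht _ (mem_of_mem_nhds hs)
  · filter_upwards [hfB, hdiff] with t ht hd z hz
    have hsub : Metric.closedBall z (ε / 2) ⊆ s ∩ U := fun w hw => hball <| by
      have := Metric.mem_closedBall.1 hw
      have h2 := Metric.mem_ball.1 hz
      have := dist_triangle w z z₀
      exact Metric.mem_closedBall.2 (by linarith)
    refine norm_deriv_le_of_forall_mem_sphere_norm_le (half_pos hε) ?_ fun w hw =>
      ht w (hsub (Metric.sphere_subset_closedBall hw)).1
    exact (hd.mono (fun w hw => (hsub hw).2)).diffContOnCl_ball subset_rfl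
  · filter_upwards [hder] with t ht z hz
    refine ht z (hball (Metric.ball_subset_closedBall
      (Metric.ball_subset_ball (by linarith) hz))).2

/-! ### The dilogarithm -/

/-- The plane cut along `[1, ∞)`, on which the principal branch of the dilogarithm is
holomorphic. -/
def cutPlane : Set ℂ := {z | 1 - z ∈ slitPlane}

theorem isOpen_cutPlane : IsOpen cutPlane :=
  isOpen_slitPlane.preimage (by fun_prop : Continuous fun z : ℂ => 1 - z)

theorem zero_mem_cutPlane : (0 : ℂ) ∈ cutPlane := by simp [cutPlane]

theorem mul_mem_cutPlane {z : ℂ} (hz : z ∈ cutPlane) {t : ℝ} (h0 : 0 ≤ t) (h1 : t ≤ 1) :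
    z * (t : ℂ) ∈ cutPlane := by
  have h : 1 + (-z) ∈ slitPlane := by simpa [cutPlane, sub_eq_add_neg] using hz
  have := starConvex_one_slitPlane.add_smul_mem h h0 h1
  simpa [cutPlane, sub_eq_add_neg, mul_comm] using this

theorem mem_cutPlane_of_re_lt_one {z : ℂ} (hz : z.re < 1) : z ∈ cutPlane :=
  mem_slitPlane_of_re_pos (one_sub_re_pos hz)

theorem hasDerivAt_log_one_sub {z : ℂ} (hz : z ∈ cutPlane) :
    HasDerivAt (fun w => log (1 - w)) (-1 / (1 - z)) z := by
  have h := ((hasDerivAt_id z).const_sub 1).clog hz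
  simpa using h

theorem differentiableOn_log_one_sub : DifferentiableOn ℂ (fun w => log (1 - w)) cutPlane :=
  fun _ hz => (hasDerivAt_log_one_sub hz).differentiableAt.differentiableWithinAt

theorem differentiableOn_dslope_log_one_sub :
    DifferentiableOn ℂ (dslope (fun w => log (1 - w)) 0) cutPlane :=
  (differentiableOn_dslope (isOpen_cutPlane.mem_nhds zero_mem_cutPlane)).2
    differentiableOn_log_one_sub

theorem log_one_sub_div_eq (z : ℂ) {t : ℝ} (ht : t ≠ 0) :
    log (1 - z * (t : ℂ)) / (t : ℂ) = z * dslope (fun w => log (1 - w)) 0 (z * t) := by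
  rcases eq_or_ne z 0 with rfl | hz
  · simp
  have ht' : (t : ℂ) ≠ 0 := ofReal_ne_zero.2 ht
  rw [dslope_of_ne _ (mul_ne_zero hz ht'), slope_def_field]
  simp only [sub_zero, log_one]
  field_simp

theorem Li2_eq (z : ℂ) :
    Li2 z = -∫ t in Ioc (0 : ℝ) 1, z * dslope (fun w => log (1 - w)) 0 (z * t) := by
  rw [Li2, intervalIntegral.integral_of_le zero_le_one]
  congr 1
  exact setIntegral_congr_fun measurableSet_Ioc fun t ht => log_one_sub_div_eq z ht.1.ne'

theorem continuousOn_dslope_comp {z : ℂ} (hz : z ∈ cutPlane) :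
    ContinuousOn (fun t : ℝ => z * dslope (fun w => log (1 - w)) 0 (z * t)) (Icc 0 1) :=
  continuousOn_const.mul (differentiableOn_dslope_log_one_sub.continuousOn.comp
    (by fun_prop) fun _ ht => mul_mem_cutPlane hz ht.1 ht.2)

theorem differentiableOn_Li2 : DifferentiableOn ℂ Li2 cutPlane := by
  have h : DifferentiableOn ℂ (fun z : ℂ => ∫ t in Ioc (0 : ℝ) 1,
      log (1 - z * (t : ℂ)) / (t : ℂ)) cutPlane := by
    refine differentiableOn_integral_of_dominated isOpen_cutPlane ?_ ?_ ?_
    · intro z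
      exact (by fun_prop :
        Measurable fun t : ℝ => log (1 - z * (t : ℂ)) / (t : ℂ)).aestronglyMeasurable
    · filter_upwards [ae_restrict_mem measurableSet_Ioc] with t ht z hz
      have := (hasDerivAt_log_one_sub (mul_mem_cutPlane hz ht.1.le ht.2)).differentiableAt.comp z
        (by fun_prop : DifferentiableAt ℂ (fun z : ℂ => z * (t : ℂ)) z)
      exact (this.div_const _).differentiableWithinAt
    · intro z₀ hz₀
      obtain ⟨ε, hε, hball⟩ := Metric.nhds_basis_closedBall.mem_iff.1
        (isOpen_cutPlane.mem_nhds hz₀)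
      obtain ⟨C, hC⟩ := ((isCompact_closedBall z₀ ε).prod
        (isCompact_Icc (a := (0 : ℝ)) (b := 1))).exists_bound_of_continuousOn
        (f := fun p : ℂ × ℝ => p.1 * dslope (fun w => log (1 - w)) 0 (p.1 * p.2))
        (continuousOn_fst.mul (differentiableOn_dslope_log_one_sub.continuousOn.comp
          (by fun_prop) fun p hp => mul_mem_cutPlane (hball hp.1) hp.2.1 hp.2.2))
      refine ⟨_, Metric.closedBall_mem_nhds z₀ hε, fun _ => C, integrable_const _, ?_⟩
      filter_upwards [ae_restrict_mem measurableSet_Ioc] with t ht z hz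
      rw [log_one_sub_div_eq z ht.1.ne']
      exact hC (z, t) ⟨hz, ht.1.le, ht.2⟩
  refine h.neg.congr fun z _ => ?_
  simp [Li2, intervalIntegral.integral_of_le zero_le_one]

theorem continuousAt_Li2 {z : ℂ} (hz : z ∈ cutPlane) : ContinuousAt Li2 z :=
  (differentiableOn_Li2.differentiableAt (isOpen_cutPlane.mem_nhds hz)).continuousAt

/-- The derivative is found along the ray through `z`, where `Li₂(c z) = -∫₀ᶜ log(1 - z t) dt / t`. -/
theorem hasDerivAt_Li2 {z : ℂ} (hz : z ∈ cutPlane) (h0 : z ≠ 0) :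
    HasDerivAt Li2 (-log (1 - z) / z) z := by
  have hd := (differentiableOn_Li2.differentiableAt (isOpen_cutPlane.mem_nhds hz)).hasDerivAt
  set φ : ℝ → ℂ := fun t => z * dslope (fun w => log (1 - w)) 0 (z * t) with hφ
  have h1 : HasDerivAt (fun c : ℝ => Li2 (z * c)) (deriv Li2 z * z) 1 := by
    have h2 : HasDerivAt (fun c : ℝ => z * (c : ℂ)) z 1 := by
      simpa using (hasDerivAt_id (1 : ℝ)).ofReal_comp.const_mul z
    have h3 : HasDerivAt Li2 (deriv Li2 z) (z * ((1 : ℝ) : ℂ)) := by simpa using hd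
    exact HasDerivAt.comp (h₂ := Li2) (h := fun c : ℝ => z * (c : ℂ)) 1 h3 h2
  have h2 : HasDerivAt (fun c : ℝ => -∫ t in (0 : ℝ)..c, φ t) (-φ 1) 1 := by
    have hcont : ContinuousAt φ 1 := by
      have : ContinuousAt (dslope (fun w => log (1 - w)) 0) (z * ((1 : ℝ) : ℂ)) :=
        (differentiableOn_dslope_log_one_sub.differentiableAt
          (isOpen_cutPlane.mem_nhds (by simpa using hz))).continuousAt
      exact continuousAt_const.mul (this.comp (f := fun t : ℝ => z * (t : ℂ)) (by fun_prop))
    refine (intervalIntegral.integral_hasDerivAt_right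
      (ContinuousOn.intervalIntegrable ?_) ?_ hcont).neg
    · rw [uIcc_of_le zero_le_one]; exact continuousOn_dslope_comp hz
    · have hm : ContinuousOn φ {t : ℝ | z * (t : ℂ) ∈ cutPlane} :=
        continuousOn_const.mul (differentiableOn_dslope_log_one_sub.continuousOn.comp
          (by fun_prop) fun _ ht => ht)
      have ho : IsOpen {t : ℝ | z * (t : ℂ) ∈ cutPlane} :=
        isOpen_cutPlane.preimage (by fun_prop)
      exact hm.stronglyMeasurableAtFilter ho 1 (by simpa using hz)
  have h3 : (fun c : ℝ => Li2 (z * c)) =ᶠ[𝓝 1] fun c : ℝ => -∫ t in (0 : ℝ)..c, φ t := by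
    filter_upwards [lt_mem_nhds (zero_lt_one (α := ℝ))] with c hc
    have := intervalIntegral.integral_comp_mul_left (a := 0) (b := 1) φ hc.ne'
    rw [mul_zero, mul_one] at this
    rw [Li2_eq, ← intervalIntegral.integral_of_le zero_le_one]
    congr 1
    rw [eq_inv_smul_iff₀ hc.ne'] at this
    rw [← this, ← intervalIntegral.integral_smul]
    refine intervalIntegral.integral_congr fun t _ => ?_
    simp only [hφ, real_smul, ofReal_mul]
    ring_nf
  have h4 := (h2.congr_of_eventuallyEq h3).unique h1
  have h5 : φ 1 = log (1 - z) := by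
    have := log_one_sub_div_eq z (one_ne_zero (α := ℝ))
    simpa [hφ] using this.symm
  rw [neg_div, ← h5, ← neg_div, h4, mul_div_cancel_right₀ _ h0]
  exact hd

theorem hasSum_Li2 {z : ℂ} (hz : ‖z‖ ≤ 1) :
    HasSum (fun n : ℕ => z ^ (n + 1) / ((n : ℂ) + 1) ^ 2) (Li2 z) := by
  have hint : ∀ n : ℕ, ∫ t in Ioc (0 : ℝ) 1, t ^ n = 1 / ((n : ℝ) + 1) := fun n => by
    rw [← intervalIntegral.integral_of_le zero_le_one, integral_pow]; simp
  have h := hasSum_integral_of_summable_integral_norm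
    (μ := volume.restrict (Ioc (0 : ℝ) 1))
    (F := fun (n : ℕ) (t : ℝ) => z ^ (n + 1) / ((n : ℂ) + 1) * ((t ^ n : ℝ) : ℂ)) ?_ ?_
  · convert! h using 1
    · ext n
      rw [integral_const_mul, integral_complex_ofReal, hint]
      push_cast
      have : (n : ℂ) + 1 ≠ 0 := by exact_mod_cast n.succ_ne_zero
      field_simp
    · rw [Li2, intervalIntegral.integral_of_le zero_le_one, ← integral_neg,
        integral_Ioc_eq_integral_Ioo, integral_Ioc_eq_integral_Ioo]
      refine setIntegral_congr_fun measurableSet_Ioo fun t ht => ?_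
      have hlt : ‖z * (t : ℂ)‖ < 1 := by
        rw [norm_mul, norm_real, Real.norm_of_nonneg ht.1.le]
        nlinarith [norm_nonneg z, ht.1, ht.2]
      have ht0 : (t : ℂ) ≠ 0 := ofReal_ne_zero.2 ht.1.ne'
      have := (hasSum_taylorSeries_neg_log' hlt).div_const (t : ℂ)
      simp only [← neg_div]
      rw [← this.tsum_eq]
      refine tsum_congr fun n => ?_
      have : (n : ℂ) + 1 ≠ 0 := by exact_mod_cast n.succ_ne_zero
      push_cast
      field_simp
      ring
  · intro n
    refine Integrable.const_mul ?_ _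
    exact ((continuous_ofReal.comp (continuous_pow n)).integrableOn_Icc).mono_set Ioc_subset_Icc_self
  · have hs : Summable fun n : ℕ => 1 / ((n : ℝ) + 1) ^ 2 := by
      have := (summable_nat_add_iff 1).2 (Real.summable_one_div_nat_pow (p := 2).2 (by norm_num))
      simpa using this
    refine Summable.of_nonneg_of_le (fun n => integral_nonneg fun t => norm_nonneg _) (fun n => ?_) hs
    have : ∀ t ∈ Ioc (0 : ℝ) 1, ‖z ^ (n + 1) / ((n : ℂ) + 1) * ((t ^ n : ℝ) : ℂ)‖
        = ‖z‖ ^ (n + 1) / ((n : ℝ) + 1) * t ^ n := fun t ht => by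
      rw [norm_mul, norm_div, norm_pow, norm_real, Real.norm_of_nonneg (pow_nonneg ht.1.le n)]
      congr 2
      exact_mod_cast Complex.norm_natCast (n + 1)
    rw [setIntegral_congr_fun measurableSet_Ioc this, integral_const_mul, hint]
    have h1 : ‖z‖ ^ (n + 1) ≤ 1 := pow_le_one₀ (norm_nonneg _) hz
    rw [div_mul_div_comm, mul_one, ← sq]
    gcongr

theorem Li2_zero : Li2 0 = 0 := by simp [Li2]

theorem Li2_neg_one : Li2 (-1) = -(Real.pi : ℂ) ^ 2 / 12 := by
  have h1 := hasSum_Li2 (z := -1) (by simp)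
  have h2 := (hasSum_one_div_nat_pow_mul_cos one_ne_zero
    (show (1 / 2 : ℝ) ∈ Icc (0 : ℝ) 1 by constructor <;> norm_num))
  have h3 := ((hasSum_nat_add_iff' 1).2 h2).mapL Complex.ofRealCLM
  have h4 : (fun n : ℕ => (-1 : ℂ) ^ (n + 1) / ((n : ℂ) + 1) ^ 2) = fun n : ℕ =>
      Complex.ofRealCLM (1 / ((n + 1 : ℕ) : ℝ) ^ (2 * 1)
        * Real.cos (2 * Real.pi * ((n + 1 : ℕ) : ℝ) * (1 / 2))) := by
    ext n
    have : 2 * Real.pi * ((n + 1 : ℕ) : ℝ) * (1 / 2) = ((n + 1 : ℕ) : ℝ) * Real.pi := by ring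
    rw [this, Real.cos_nat_mul_pi]
    simp
    ring
  rw [h4] at h1
  rw [h1.unique h3]
  have hB : (Polynomial.map (algebraMap ℚ ℝ) (Polynomial.bernoulli 2)).eval (1 / 2 : ℝ)
      = -1 / 12 := by
    simp [Polynomial.bernoulli, Finset.sum_range_succ, bernoulli_eq_bernoulli'_of_ne_one]
    norm_num
  norm_num [hB, Nat.factorial]
  ring

/-! ### Landen's identity, reflection and inversion -/

theorem one_sub_div_sub_one {z : ℂ} (hz : 1 - z ≠ 0) : 1 - z / (z - 1) = (1 - z)⁻¹ := by
  have : z - 1 ≠ 0 := fun h => hz (by linear_combination -h)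
  field_simp
  ring

theorem div_sub_one_mem_cutPlane {z : ℂ} (hz : z.re < 1) : z / (z - 1) ∈ cutPlane := by
  have h := one_sub_re_pos hz
  refine mem_slitPlane_of_re_pos ?_
  rw [one_sub_div_sub_one (ne_zero_of_re_pos h)]
  exact inv_re_pos h

theorem log_one_sub_div_sub_one {z : ℂ} (hz : z.re < 1) :
    log (1 - z / (z - 1)) = -log (1 - z) := by
  have h := one_sub_re_pos hz
  rw [one_sub_div_sub_one (ne_zero_of_re_pos h), log_inv_of_re_pos h]

/-- Landen's identity. -/
theorem Li2_add_Li2_div_sub_one {z : ℂ} (hz : z.re < 1) :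
    Li2 z + Li2 (z / (z - 1)) = -log (1 - z) ^ 2 / 2 := by
  rcases eq_or_ne z 0 with rfl | hz0
  · simp [Li2_zero]
  set H : ℂ → ℂ := fun w => Li2 w + Li2 (w / (w - 1)) + log (1 - w) ^ 2 / 2 with hH
  have hre : ∀ t ∈ Icc (0 : ℝ) 1, (((1 - t : ℝ) : ℂ) * z).re < 1 := fun t ht => by
    rw [re_ofReal_mul]
    rcases le_or_gt z.re 0 with h | h <;> nlinarith [ht.1, ht.2]
  have hcont : ∀ w : ℂ, w.re < 1 → ContinuousAt H w := fun w hw => by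
    have h1 : w - 1 ≠ 0 := fun h => ne_zero_of_re_pos (one_sub_re_pos hw) (by linear_combination -h)
    refine ((continuousAt_Li2 (mem_cutPlane_of_re_lt_one hw)).add ?_).add ?_
    · exact ContinuousAt.comp (f := fun w : ℂ => w / (w - 1))
        (continuousAt_Li2 (div_sub_one_mem_cutPlane hw))
        (continuousAt_id.div (by fun_prop) h1)
    · exact ((hasDerivAt_log_one_sub (mem_cutPlane_of_re_lt_one hw)).continuousAt.pow 2).div_const _
  have hder : ∀ w : ℂ, w.re < 1 → w ≠ 0 → HasDerivAt H 0 w := fun w hw hw0 => by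
    have h1 : w - 1 ≠ 0 := fun h => ne_zero_of_re_pos (one_sub_re_pos hw) (by linear_combination -h)
    have h1' : 1 - w ≠ 0 := ne_zero_of_re_pos (one_sub_re_pos hw)
    have hd : HasDerivAt (fun w : ℂ => w / (w - 1)) ((1 * (w - 1) - w * 1) / (w - 1) ^ 2) w :=
      (hasDerivAt_id w).div ((hasDerivAt_id w).sub_const 1) h1
    have h2 := (hasDerivAt_Li2 (div_sub_one_mem_cutPlane hw) (div_ne_zero hw0 h1)).comp w hd
    have h3 := ((hasDerivAt_log_one_sub (mem_cutPlane_of_re_lt_one hw)).pow 2).div_const 2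
    refine (((hasDerivAt_Li2 (mem_cutPlane_of_re_lt_one hw) hw0).add h2).add h3).congr_deriv ?_
    rw [log_one_sub_div_sub_one hw]
    have : (1 - w) = -(w - 1) := by ring
    push_cast
    rw [this]
    field_simp
    ring
  -- Only `H' = 0` away from `0` is at hand, so follow `H` along the segment from `z` to `0`.
  have key := constant_of_has_deriv_right_zero (f := fun t : ℝ => H (((1 - t : ℝ) : ℂ) * z))
    (a := 0) (b := 1) ?_ ?_ 1 ⟨zero_le_one, le_rfl⟩
  · simp [hH, Li2_zero] at key
    linear_combination -key
  · exact fun t ht => (ContinuousAt.comp (f := fun t : ℝ => ((1 - t : ℝ) : ℂ) * z)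
      (hcont _ (hre t ht)) (by fun_prop)).continuousWithinAt
  · intro t ht
    have h1 : HasDerivAt (fun t : ℝ => ((1 - t : ℝ) : ℂ) * z) (((-1 : ℝ) : ℂ) * z) t :=
      (((hasDerivAt_id t).const_sub 1).ofReal_comp).mul_const z
    have h2 := hder _ (hre t ⟨ht.1, ht.2.le⟩)
      (mul_ne_zero (ofReal_ne_zero.2 (sub_ne_zero.2 ht.2.ne')) hz0)
    have := HasDerivAt.comp (h₂ := H) (h := fun t : ℝ => ((1 - t : ℝ) : ℂ) * z) t h2 h1
    simpa [Function.comp_def] using this.hasDerivWithinAt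

/-- The constant is found at `z = 1 / 2`, from Landen's identity at `-1`. -/
theorem Li2_add_Li2_one_sub {z : ℂ} (h0 : 0 < z.re) (h1 : z.re < 1) :
    Li2 z + Li2 (1 - z) = (Real.pi : ℂ) ^ 2 / 6 - log z * log (1 - z) := by
  have hopen : IsOpen {w : ℂ | 0 < w.re ∧ w.re < 1} :=
    (isOpen_lt continuous_const continuous_re).inter (isOpen_lt continuous_re continuous_const)
  have hconn : IsPreconnected {w : ℂ | 0 < w.re ∧ w.re < 1} :=
    ((convex_halfSpace_re_gt 0).inter (convex_halfSpace_re_lt 1)).isPreconnected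
  set H : ℂ → ℂ := fun w => Li2 w + Li2 (1 - w) + log w * log (1 - w) with hH
  have hder : ∀ w ∈ {w : ℂ | 0 < w.re ∧ w.re < 1}, HasDerivAt H 0 w := fun w ⟨hw0, hw1⟩ => by
    have e0 := ne_zero_of_re_pos hw0
    have e1 := ne_zero_of_re_pos (one_sub_re_pos hw1)
    have m1 := mem_cutPlane_of_re_lt_one hw1
    have m2 : 1 - w ∈ cutPlane := mem_cutPlane_of_re_lt_one (by simpa using hw0)
    have d2 := (hasDerivAt_Li2 m2 e1).comp w ((hasDerivAt_id w).const_sub 1)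
    have d3 := ((hasDerivAt_id w).clog (mem_slitPlane_of_re_pos hw0)).mul (hasDerivAt_log_one_sub m1)
    refine (((hasDerivAt_Li2 m1 e0).add d2).add d3).congr_deriv ?_
    simp only [id, sub_sub_cancel]
    field_simp
    ring
  have key := hopen.is_const_of_deriv_eq_zero hconn
    (fun w hw => (hder w hw).differentiableAt.differentiableWithinAt)
    (fun w hw => (hder w hw).deriv) (x := z) (y := 1 / 2) ⟨h0, h1⟩ (by constructor <;> norm_num)
  have hl := Li2_add_Li2_div_sub_one (z := -1) (by norm_num)
  have hlog : log (1 / 2 : ℂ) = -log 2 := by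
    rw [one_div, log_inv_of_re_pos (by norm_num)]
  have e1 : (1 : ℂ) - 1 / 2 = 1 / 2 := by norm_num
  have e2 : (-1 : ℂ) / (-1 - 1) = 1 / 2 := by norm_num
  have e3 : (1 : ℂ) - -1 = 2 := by norm_num
  rw [e2, e3, Li2_neg_one] at hl
  simp only [hH, e1, hlog] at key
  linear_combination key + 2 * hl

theorem isPreconnected_slitPlane : IsPreconnected slitPlane :=
  (starConvex_one_slitPlane.isPathConnected one_mem_slitPlane).isConnected.isPreconnected

theorem isPreconnected_neg_mem_slitPlane : IsPreconnected {w : ℂ | -w ∈ slitPlane} := by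
  have : {w : ℂ | -w ∈ slitPlane} = (fun w : ℂ => -w) '' slitPlane := by
    ext w; exact ⟨fun h => ⟨-w, h, neg_neg w⟩, by rintro ⟨v, hv, rfl⟩; simpa using hv⟩
  rw [this]
  exact isPreconnected_slitPlane.image _ (by fun_prop)

theorem isOpen_neg_mem_slitPlane : IsOpen {w : ℂ | -w ∈ slitPlane} :=
  isOpen_slitPlane.preimage (by fun_prop)

theorem inv_mem_slitPlane_of_mem {w : ℂ} (hw : w ∈ slitPlane) : w⁻¹ ∈ slitPlane := by
  rw [mem_slitPlane_iff_arg] at hw ⊢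
  refine ⟨?_, inv_ne_zero hw.2⟩
  rw [arg_inv, if_neg hw.1]
  have := neg_pi_lt_arg w
  intro h; linarith

theorem one_add_mem_slitPlane {w : ℂ} (hw : w ∈ slitPlane) : 1 + w ∈ slitPlane := by
  rcases hw with h | h
  · exact Or.inl (by rw [add_re, one_re]; linarith)
  · exact Or.inr (by rwa [add_im, one_im, zero_add])

theorem mem_cutPlane_of_neg_mem {w : ℂ} (hw : -w ∈ slitPlane) : w ∈ cutPlane := by
  simpa only [cutPlane, mem_ofPred_eq, sub_eq_add_neg] using one_add_mem_slitPlane hw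

theorem inv_mem_cutPlane_of_neg_mem {w : ℂ} (hw : -w ∈ slitPlane) : w⁻¹ ∈ cutPlane :=
  mem_cutPlane_of_neg_mem (by rw [neg_inv]; exact inv_mem_slitPlane_of_mem hw)

theorem hasDerivAt_log_neg {w : ℂ} (hw : -w ∈ slitPlane) :
    HasDerivAt (fun z => log (-z)) (1 / w) w := by
  have := (hasDerivAt_id w).neg.clog hw
  simpa [neg_div_neg_eq] using this

theorem log_one_sub_inv_add_log_neg {z : ℂ} (hz : -z ∈ slitPlane) :
    log (1 - z⁻¹) + log (-z) = log (1 - z) := by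
  have hder : ∀ w ∈ {w : ℂ | -w ∈ slitPlane},
      HasDerivAt (fun w : ℂ => log (1 - w⁻¹) + log (-w) - log (1 - w)) 0 w := fun w hw => by
    have e0 : w ≠ 0 := neg_ne_zero.1 (slitPlane_ne_zero hw)
    have m1 := mem_cutPlane_of_neg_mem hw
    have m2 := inv_mem_cutPlane_of_neg_mem hw
    refine (((((hasDerivAt_log_one_sub m2).comp w (hasDerivAt_inv e0))).add
      (hasDerivAt_log_neg hw)).sub (hasDerivAt_log_one_sub m1)).congr_deriv ?_
    have e1 : 1 - w ≠ 0 := slitPlane_ne_zero m1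
    have e2 : w - 1 ≠ 0 := fun h => e1 (by linear_combination -h)
    have e3 : 1 - w⁻¹ = (w - 1) / w := by field_simp
    have e4 : (1 - w) = -(w - 1) := by ring
    rw [e3, e4]
    field_simp
    ring
  have key := isOpen_neg_mem_slitPlane.is_const_of_deriv_eq_zero isPreconnected_neg_mem_slitPlane
    (fun w hw => (hder w hw).differentiableAt.differentiableWithinAt)
    (fun w hw => (hder w hw).deriv) (x := z) (y := -1) hz (by simp)
  simp only [inv_neg, inv_one, neg_neg, log_one, add_zero, sub_self] at key
  linear_combination key

/-- Inversion; the constant is found at `z = -1`. -/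
theorem Li2_add_Li2_inv {z : ℂ} (hz : -z ∈ slitPlane) :
    Li2 z + Li2 z⁻¹ = -(Real.pi : ℂ) ^ 2 / 6 - log (-z) ^ 2 / 2 := by
  have hder : ∀ w ∈ {w : ℂ | -w ∈ slitPlane},
      HasDerivAt (fun w : ℂ => Li2 w + Li2 w⁻¹ + log (-w) ^ 2 / 2) 0 w := fun w hw => by
    have e0 : w ≠ 0 := neg_ne_zero.1 (slitPlane_ne_zero hw)
    have m1 := mem_cutPlane_of_neg_mem hw
    have m2 := inv_mem_cutPlane_of_neg_mem hw
    refine (((hasDerivAt_Li2 m1 e0).add ((hasDerivAt_Li2 m2 (inv_ne_zero e0)).comp w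
      (hasDerivAt_inv e0))).add (((hasDerivAt_log_neg hw).pow 2).div_const 2)).congr_deriv ?_
    rw [← log_one_sub_inv_add_log_neg hw]
    push_cast
    field_simp
    ring
  have key := isOpen_neg_mem_slitPlane.is_const_of_deriv_eq_zero isPreconnected_neg_mem_slitPlane
    (fun w hw => (hder w hw).differentiableAt.differentiableWithinAt)
    (fun w hw => (hder w hw).deriv) (x := z) (y := -1) hz (by simp)
  simp only [inv_neg, inv_one, neg_neg, log_one, Li2_neg_one] at key
  linear_combination key

/-! ### The integral in homogeneous form -/

/-- The integrand of `K`: the form `log (1 - u e^{-a r}) d log (1 - v e^{-b r})`. -/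
noncomputable def kernel (a b u v : ℂ) (r : ℝ) : ℂ :=
  log (1 - u * exp (-(a * r))) * (v * b * exp (-(b * r)) / (1 - v * exp (-(b * r))))

/-- The homogeneous form of the Herglotz-Zagier-Novikov function: `K a b u v` depends on `(a, b)`
only through `x = a / b`, and equals `𝓕(x; u, v)`. -/
noncomputable def K (a b u v : ℂ) : ℂ := ∫ r in Ioi (0 : ℝ), kernel a b u v r

theorem exp_neg_mul_eq_cpow (a : ℂ) (r : ℝ) :
    exp (-(a * r)) = ((Real.exp (-r) : ℝ) : ℂ) ^ a := by
  rw [cpow_def_of_ne_zero (ofReal_ne_zero.2 (Real.exp_pos _).ne'), ← ofReal_log (Real.exp_pos _).le,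
    Real.log_exp]
  congr 1
  push_cast
  ring

theorem norm_mul_cpow_lt_one {u : ℂ} (hu : u ∈ disk) {a : ℂ} (ha : 0 < a.re) {t : ℝ}
    (h0 : 0 ≤ t) (h1 : t < 1) : ‖u * (t : ℂ) ^ a‖ < 1 := by
  rw [norm_mul, norm_cpow_eq_rpow_re_of_nonneg h0 ha.ne']
  have := Real.rpow_lt_one h0 h1 ha
  have h2 := Real.rpow_nonneg h0 a.re
  nlinarith [hu.2.1, norm_nonneg u]

theorem re_mul_cpow_lt_one {u : ℂ} (hu : u ∈ disk) {a : ℂ} (ha : 0 < a.re) {t : ℝ}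
    (h0 : 0 ≤ t) (h1 : t ≤ 1) : (u * (t : ℂ) ^ a).re < 1 := by
  rcases h1.eq_or_lt with rfl | h1
  · simpa using re_lt_one hu.2.1 hu.2.2
  · exact (re_le_norm _).trans_lt (norm_mul_cpow_lt_one hu ha h0 h1)

theorem norm_mul_exp_lt_one {u : ℂ} (hu : u ∈ disk) {a : ℂ} (ha : 0 < a.re) {r : ℝ}
    (hr : 0 < r) : ‖u * exp (-(a * r))‖ < 1 := by
  rw [exp_neg_mul_eq_cpow]
  exact norm_mul_cpow_lt_one hu ha (Real.exp_pos _).le (Real.exp_lt_one_iff.2 (by linarith))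

theorem re_mul_exp_lt_one {u : ℂ} (hu : u ∈ disk) {a : ℂ} (ha : 0 < a.re) {r : ℝ}
    (hr : 0 ≤ r) : (u * exp (-(a * r))).re < 1 := by
  rw [exp_neg_mul_eq_cpow]
  exact re_mul_cpow_lt_one hu ha (Real.exp_pos _).le (Real.exp_le_one_iff.2 (by linarith))

/-- The values `u e^{-a r}`, `r ≥ 0`, stay in a compact part of `Re w < 1`, locally uniformly in
`a`: with `t = e^{-r}` they are `u tᵃ` with `t` in `[0, 1]`. -/
theorem exists_bound_comp_mul_exp {u : ℂ} (hu : u ∈ disk) {φ : ℂ → ℂ}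
    (hφ : ContinuousOn φ {w | w.re < 1}) {S : Set ℂ} (hS : IsCompact S)
    (hre : ∀ a ∈ S, 0 < a.re) :
    ∃ C, 0 ≤ C ∧ ∀ a ∈ S, ∀ r : ℝ, 0 ≤ r → ‖φ (u * exp (-(a * r)))‖ ≤ C := by
  have hc : ContinuousOn (fun p : ℝ × ℂ => u * (p.1 : ℂ) ^ p.2) (Icc (0 : ℝ) 1 ×ˢ S) :=
    continuousOn_const.mul fun p hp =>
      (continuousAt_ofReal_cpow p.1 p.2 (Or.inl (hre _ hp.2))).continuousWithinAt
  obtain ⟨C, hC⟩ := (isCompact_Icc.prod hS).exists_bound_of_continuousOn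
    (hφ.comp hc fun p hp => re_mul_cpow_lt_one hu (hre _ hp.2) hp.1.1 hp.1.2)
  refine ⟨max C 0, le_max_right _ _, fun a ha r hr => le_trans ?_ (le_max_left _ _)⟩
  rw [exp_neg_mul_eq_cpow]
  exact hC (Real.exp (-r), a) ⟨⟨(Real.exp_pos _).le, Real.exp_le_one_iff.2 (by linarith)⟩, ha⟩

theorem continuousOn_log_one_sub : ContinuousOn (fun w => log (1 - w)) {w | w.re < 1} :=
  differentiableOn_log_one_sub.continuousOn.mono fun _ hw => mem_cutPlane_of_re_lt_one hw

theorem continuousOn_inv_one_sub : ContinuousOn (fun w : ℂ => (1 - w)⁻¹) {w | w.re < 1} :=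
  ContinuousOn.inv₀ (by fun_prop) fun _ hw => ne_zero_of_re_pos (one_sub_re_pos hw)

theorem norm_exp_neg_mul (b : ℂ) (r : ℝ) : ‖exp (-(b * r))‖ = Real.exp (-(b.re * r)) := by
  rw [norm_exp]; simp

theorem exists_bound_kernel {u v : ℂ} (hu : u ∈ disk) (hv : v ∈ disk) {S T : Set ℂ}
    (hS : IsCompact S) (hT : IsCompact T) (hSre : ∀ a ∈ S, 0 < a.re) {β : ℝ} (hβ : 0 < β)
    (hTre : ∀ b ∈ T, β ≤ b.re) :
    ∃ C, ∀ a ∈ S, ∀ b ∈ T, ∀ r : ℝ, 0 ≤ r → ‖kernel a b u v r‖ ≤ C * Real.exp (-β * r) := by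
  obtain ⟨C₁, hC₁, h₁⟩ := exists_bound_comp_mul_exp hu continuousOn_log_one_sub hS hSre
  obtain ⟨C₂, hC₂, h₂⟩ := exists_bound_comp_mul_exp hv continuousOn_inv_one_sub hT
    fun b hb => hβ.trans_le (hTre b hb)
  obtain ⟨C₃, h₃⟩ := hT.exists_bound_of_continuousOn (continuousOn_id (s := T))
  refine ⟨C₁ * (C₃ * C₂), fun a ha b hb r hr => ?_⟩
  have hC₃ : 0 ≤ C₃ := (norm_nonneg _).trans (h₃ b hb)
  have e : kernel a b u v r = log (1 - u * exp (-(a * r))) *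
      (v * b * exp (-(b * r)) * (1 - v * exp (-(b * r)))⁻¹) := by rw [kernel, div_eq_mul_inv]
  rw [e, norm_mul, norm_mul, norm_mul, norm_mul, norm_exp_neg_mul]
  have h4 : Real.exp (-(b.re * r)) ≤ Real.exp (-β * r) :=
    Real.exp_le_exp.2 (by nlinarith [hTre b hb])
  calc _ ≤ C₁ * (1 * C₃ * Real.exp (-β * r) * C₂) := by
        gcongr
        · exact h₁ a ha r hr
        · exact hv.2.1
        · exact h₃ b hb
        · exact h₂ b hb r hr
    _ = _ := by ring

theorem measurable_kernel (a b u v : ℂ) : Measurable (kernel a b u v) := by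
  unfold kernel
  fun_prop

theorem integrableOn_exp_mul {β : ℝ} (hβ : 0 < β) (C : ℝ) :
    IntegrableOn (fun r : ℝ => C * Real.exp (-β * r)) (Ioi 0) :=
  (exp_neg_integrableOn_Ioi 0 hβ).const_mul C

theorem integrableOn_kernel {u v : ℂ} (hu : u ∈ disk) (hv : v ∈ disk) {a b : ℂ} (ha : 0 < a.re)
    (hb : 0 < b.re) : IntegrableOn (kernel a b u v) (Ioi 0) := by
  obtain ⟨C, hC⟩ := exists_bound_kernel hu hv (isCompact_singleton (x := a))
    (isCompact_singleton (x := b)) (by simpa using ha) hb (by simp)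
  refine (integrableOn_exp_mul hb C).mono' (measurable_kernel a b u v).aestronglyMeasurable ?_
  filter_upwards [ae_restrict_mem measurableSet_Ioi] with r hr
  exact hC a rfl b rfl r (le_of_lt hr)

theorem hasDerivAt_log_one_sub_mul_exp {u : ℂ} (hu : u ∈ disk) {a : ℂ} (ha : 0 < a.re) {r : ℝ}
    (hr : 0 ≤ r) : HasDerivAt (fun r : ℝ => log (1 - u * exp (-(a * r))))
      (u * a * exp (-(a * r)) / (1 - u * exp (-(a * r)))) r := by
  have h1 : HasDerivAt (fun r : ℝ => u * exp (-(a * r))) (u * (exp (-(a * r)) * -(a * 1))) r :=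
    ((((hasDerivAt_id r).ofReal_comp).const_mul a).neg.cexp).const_mul u
  have h2 := hasDerivAt_log_one_sub (mem_cutPlane_of_re_lt_one (re_mul_exp_lt_one hu ha hr))
  refine (HasDerivAt.comp (h₂ := fun w => log (1 - w)) r h2 h1).congr_deriv ?_
  ring

theorem differentiableOn_K {u v : ℂ} (hu : u ∈ disk) (hv : v ∈ disk) {U : Set ℂ} (hU : IsOpen U)
    {a b : ℂ → ℂ} (ha : DifferentiableOn ℂ a U) (hb : DifferentiableOn ℂ b U)
    (hare : ∀ z ∈ U, 0 < (a z).re) (hbre : ∀ z ∈ U, 0 < (b z).re) :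
    DifferentiableOn ℂ (fun z => K (a z) (b z) u v) U := by
  refine differentiableOn_integral_of_dominated hU
    (fun z => (measurable_kernel _ _ u v).aestronglyMeasurable) ?_ ?_
  · filter_upwards [ae_restrict_mem measurableSet_Ioi] with r hr
    have hr' : (0 : ℝ) ≤ r := le_of_lt hr
    have h1 : DifferentiableOn ℂ (fun z => exp (-(a z * r))) U := (ha.mul_const _).neg.cexp
    have h2 : DifferentiableOn ℂ (fun z => exp (-(b z * r))) U := (hb.mul_const _).neg.cexp
    unfold kernel
    refine DifferentiableOn.mul ?_ (DifferentiableOn.div ?_ ?_ ?_)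
    · exact (((h1.const_mul u).const_sub 1)).clog fun z hz =>
        mem_cutPlane_of_re_lt_one (re_mul_exp_lt_one hu (hare z hz) hr')
    · exact (hb.const_mul v).mul h2
    · exact (h2.const_mul v).const_sub 1
    · exact fun z hz => ne_zero_of_re_pos (one_sub_re_pos (re_mul_exp_lt_one hv (hbre z hz) hr'))
  · intro z₀ hz₀
    obtain ⟨ε, hε, hball⟩ := Metric.nhds_basis_closedBall.mem_iff.1 (hU.mem_nhds hz₀)
    have hk := isCompact_closedBall z₀ ε
    have hbk := hk.image_of_continuousOn (hb.continuousOn.mono hball)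
    obtain ⟨b₀, ⟨w, hw, rfl⟩, hmin⟩ := hbk.exists_isMinOn
      ⟨_, mem_image_of_mem b (Metric.mem_closedBall_self hε.le)⟩ continuous_re.continuousOn
    obtain ⟨C, hC⟩ := exists_bound_kernel hu hv
      (hk.image_of_continuousOn (ha.continuousOn.mono hball)) hbk
      (by rintro _ ⟨z, hz, rfl⟩; exact hare z (hball hz)) (hbre w (hball hw)) (fun b' hb' => hmin hb')
    refine ⟨_, Metric.closedBall_mem_nhds z₀ hε, _, integrableOn_exp_mul (hbre w (hball hw)) C, ?_⟩
    filter_upwards [ae_restrict_mem measurableSet_Ioi] with r hr z hz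
    exact hC _ (mem_image_of_mem a hz) _ (mem_image_of_mem b hz) r (le_of_lt hr)

theorem K_smul (a b u v : ℂ) {c : ℝ} (hc : 0 < c) : K (c * a) (c * b) u v = K a b u v := by
  have h := integral_comp_mul_left_Ioi (kernel a b u v) 0 hc
  rw [mul_zero, eq_inv_smul_iff₀ hc.ne', ← integral_smul] at h
  rw [K, K, ← h]
  refine integral_congr_ae (Eventually.of_forall fun r => ?_)
  simp only [kernel, real_smul, ofReal_mul]
  ring_nf

theorem inv_sub_ne_zero {v : ℂ} (hv : v ∈ disk) {t : ℝ} (h0 : 0 ≤ t) (h1 : t ≤ 1) :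
    v⁻¹ - (t : ℂ) ≠ 0 := fun h => by
  have h2 := re_mul_cpow_lt_one hv (a := 1) (by simp) h0 h1
  rw [cpow_one, ← sub_eq_zero.1 h, mul_inv_cancel₀ hv.1] at h2
  simp at h2

theorem continuousOn_integrand {u v : ℂ} (hu : u ∈ disk) (hv : v ∈ disk) {x : ℂ} (hx : 0 < x.re) :
    ContinuousOn (integrand x u v) (Icc 0 1) := by
  unfold integrand
  refine ContinuousOn.div ?_ (by fun_prop) fun t ht => inv_sub_ne_zero hv ht.1 ht.2
  exact continuousOn_log_one_sub.comp
    ((continuous_ofReal_cpow_const hx).const_mul u).continuousOn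
    fun t ht => re_mul_cpow_lt_one hu hx ht.1 ht.2

theorem intervalIntegrable_integrand {u v : ℂ} (hu : u ∈ disk) (hv : v ∈ disk) {x : ℂ}
    (hx : 0 < x.re) : IntervalIntegrable (integrand x u v) volume 0 1 :=
  ContinuousOn.intervalIntegrable (by
    rw [uIcc_of_le zero_le_one]; exact continuousOn_integrand hu hv hx)

/-- The substitution `t = e^{-r}`. -/
theorem integral_eq_K {v : ℂ} (hv : v ∈ disk) (x u : ℂ) : integral x u v = K x 1 u v := by
  have himg : (fun r : ℝ => Real.exp (-r)) '' Ioi 0 = Ioo 0 1 := by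
    ext t
    constructor
    · rintro ⟨r, hr, rfl⟩
      exact ⟨Real.exp_pos _, Real.exp_lt_one_iff.2 (neg_lt_zero.2 hr)⟩
    · rintro ⟨h0, h1⟩
      exact ⟨-Real.log t, neg_pos.2 (Real.log_neg h0 h1), by simp [Real.exp_log h0]⟩
  have h := integral_image_eq_integral_abs_deriv_smul (s := Ioi (0 : ℝ))
    (f := fun r : ℝ => Real.exp (-r)) (f' := fun r => Real.exp (-r) * -1) measurableSet_Ioi
    (fun r _ => ((hasDerivAt_id r).neg.exp).hasDerivWithinAt)
    (fun r _ s _ hrs => by simpa using hrs) (integrand x u v)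
  rw [himg] at h
  rw [integral, intervalIntegral.integral_of_le zero_le_one, integral_Ioc_eq_integral_Ioo, h, K]
  refine setIntegral_congr_fun measurableSet_Ioi fun r hr => ?_
  have h1 : v⁻¹ - ((Real.exp (-r) : ℝ) : ℂ) ≠ 0 := inv_sub_ne_zero hv (Real.exp_pos _).le
    (Real.exp_le_one_iff.2 (neg_nonpos.2 (le_of_lt hr)))
  have h2 : exp (-(1 * (r : ℂ))) = ((Real.exp (-r) : ℝ) : ℂ) := by push_cast; simp
  have h3 : 1 - v * ((Real.exp (-r) : ℝ) : ℂ) = v * (v⁻¹ - ((Real.exp (-r) : ℝ) : ℂ)) := by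
    rw [mul_sub, mul_inv_cancel₀ hv.1]
  have h4 := hv.1
  simp only [kernel, integrand, h2, h3, exp_neg_mul_eq_cpow x, real_smul, mul_neg, mul_one, abs_neg,
    abs_of_pos (Real.exp_pos (-r))]
  field_simp

/-! ### Continuation, the two-term equation and the double series -/

/-- The identity theorem, for functions that agree on a real interval. -/
theorem eqOn_of_eq_on_reals {U : Set ℂ} (hU : IsOpen U) (hc : IsPreconnected U) {f g : ℂ → ℂ}
    (hf : DifferentiableOn ℂ f U) (hg : DifferentiableOn ℂ g U) {α β : ℝ} (hαβ : α < β)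
    (hmem : ∀ t ∈ Ioo α β, (t : ℂ) ∈ U) (h : ∀ t ∈ Ioo α β, f t = g t) : EqOn f g U := by
  obtain ⟨c, hc0⟩ := nonempty_Ioo.2 hαβ
  refine (hf.analyticOnNhd hU).eqOn_of_preconnected_of_frequently_eq (hg.analyticOnNhd hU) hc
    (hmem c hc0) ?_
  have ht : Tendsto (fun t : ℝ => (t : ℂ)) (𝓝[≠] c) (𝓝[≠] (c : ℂ)) :=
    (continuous_ofReal.continuousWithinAt (s := {c}ᶜ) (x := c)).tendsto_nhdsWithin
      fun t ht => by simpa using ht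
  refine ht.frequently (Eventually.frequently ?_)
  filter_upwards [nhdsWithin_le_nhds (isOpen_Ioo.mem_nhds hc0)] with t ht using h t ht

theorem csqrt_sq (z : ℂ) : csqrt z ^ 2 = z := by
  rw [csqrt, ← cpow_nat_mul]; simp

theorem csqrt_re_pos {z : ℂ} (hz : z ∈ slitPlane) : 0 < (csqrt z).re := by
  rw [mem_slitPlane_iff_arg] at hz
  have h1 := lt_of_le_of_ne (arg_le_pi z) hz.1
  have h2 := neg_pi_lt_arg z
  rw [csqrt, cpow_def_of_ne_zero hz.2, exp_re]
  refine mul_pos (Real.exp_pos _) (Real.cos_pos_of_mem_Ioo ⟨?_, ?_⟩) <;>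
  · have : (log z * (1 / 2)).im = z.arg / 2 := by
      have : log z * (1 / 2) = log z / ((2 : ℝ) : ℂ) := by push_cast; ring
      rw [this, div_ofReal_im, log_im]
    rw [this]
    linarith

theorem differentiableOn_csqrt : DifferentiableOn ℂ csqrt slitPlane := fun _ hz =>
  ((hasDerivAt_id _).cpow_const hz).differentiableAt.differentiableWithinAt

theorem csqrt_inv {z : ℂ} (hz : z ∈ slitPlane) : csqrt z⁻¹ = (csqrt z)⁻¹ := by
  rw [csqrt, csqrt, inv_cpow _ _ (mem_slitPlane_iff_arg.1 hz).1]

theorem csqrt_ofReal {t : ℝ} (ht : 0 ≤ t) : csqrt t = (Real.sqrt t : ℝ) := by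
  rw [csqrt, Real.sqrt_eq_rpow, ofReal_cpow ht]
  push_cast
  rfl

theorem isContinuation_K {u v : ℂ} (hu : u ∈ disk) (hv : v ∈ disk) :
    IsContinuation u v (fun x => K (csqrt x) (csqrt x)⁻¹ u v) := by
  have hd : DifferentiableOn ℂ (fun x => K (csqrt x) (csqrt x)⁻¹ u v) slitPlane :=
    differentiableOn_K hu hv isOpen_slitPlane differentiableOn_csqrt
      (differentiableOn_csqrt.inv fun z hz => ne_zero_of_re_pos (csqrt_re_pos hz))
      (fun z hz => csqrt_re_pos hz) fun z hz => inv_re_pos (csqrt_re_pos hz)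
  refine ⟨hd, ?_⟩
  have h2 : DifferentiableOn ℂ (fun x => K x 1 u v) {x | 0 < x.re} :=
    differentiableOn_K hu hv (isOpen_lt continuous_const continuous_re) differentiableOn_id
      (differentiableOn_const 1) (fun z hz => hz) fun z _ => by simp
  have key := eqOn_of_eq_on_reals (isOpen_lt continuous_const continuous_re)
    (convex_halfSpace_re_gt 0).isPreconnected (hd.mono fun z hz => mem_slitPlane_of_re_pos hz) h2
    (zero_lt_one (α := ℝ)) (fun t ht => by simpa using ht.1) fun t ht => by
      have hs := Real.sqrt_pos.2 ht.1
      have hs' : ((Real.sqrt t : ℝ) : ℂ) ≠ 0 := ofReal_ne_zero.2 hs.ne'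
      have := K_smul (csqrt t) (csqrt t)⁻¹ u v hs
      rw [csqrt_ofReal ht.1.le, ← ofReal_mul, Real.mul_self_sqrt ht.1.le, mul_inv_cancel₀ hs'] at this
      rw [csqrt_ofReal ht.1.le]
      exact this.symm
  intro x hx
  rw [integral_eq_K hv]
  exact key hx

theorem isContinuation_F {u v : ℂ} (hu : u ∈ disk) (hv : v ∈ disk) :
    IsContinuation u v (fun x => F x u v) := by
  have h : ∃ g : ℂ → ℂ, IsContinuation u v g := ⟨_, isContinuation_K hu hv⟩
  have e : (fun x => F x u v) = h.choose := by
    funext x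
    rw [F, dif_pos h]
  rw [e]
  exact h.choose_spec

theorem F_eq_K_of_re_pos {u v : ℂ} (hu : u ∈ disk) (hv : v ∈ disk) {x : ℂ} (hx : 0 < x.re) :
    F x u v = K x 1 u v := by
  rw [← integral_eq_K hv]
  exact (isContinuation_F hu hv).2 x hx

theorem F_eq_K {u v : ℂ} (hu : u ∈ disk) (hv : v ∈ disk) {x : ℂ} (hx : x ∈ slitPlane) :
    F x u v = K (csqrt x) (csqrt x)⁻¹ u v := by
  refine eqOn_of_eq_on_reals isOpen_slitPlane isPreconnected_slitPlane (isContinuation_F hu hv).1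
    (isContinuation_K hu hv).1 (zero_lt_one (α := ℝ))
    (fun t ht => mem_slitPlane_of_re_pos (by simpa using ht.1)) (fun t ht => ?_) hx
  have ht' : 0 < (t : ℂ).re := by simpa using ht.1
  exact ((isContinuation_F hu hv).2 _ ht').trans ((isContinuation_K hu hv).2 _ ht').symm

theorem tendsto_mul_exp_atTop (u : ℂ) {a : ℂ} (ha : 0 < a.re) :
    Tendsto (fun r : ℝ => u * exp (-(a * r))) atTop (𝓝 0) := by
  rw [tendsto_zero_iff_norm_tendsto_zero]
  simp only [norm_mul, norm_exp_neg_mul]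
  have := ((Real.tendsto_exp_neg_atTop_nhds_zero.comp
    (tendsto_id.const_mul_atTop ha)).const_mul ‖u‖)
  simpa using this

theorem tendsto_log_one_sub_mul_exp_atTop (u : ℂ) {a : ℂ} (ha : 0 < a.re) :
    Tendsto (fun r : ℝ => log (1 - u * exp (-(a * r)))) atTop (𝓝 0) := by
  have h := (hasDerivAt_log_one_sub zero_mem_cutPlane).continuousAt.tendsto.comp
    (tendsto_mul_exp_atTop u ha)
  simpa [Function.comp_def] using h

/-- Integration by parts. -/
theorem K_add_K {u v : ℂ} (hu : u ∈ disk) (hv : v ∈ disk) {a b : ℂ} (ha : 0 < a.re)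
    (hb : 0 < b.re) : K a b u v + K b a v u = -(log (1 - u) * log (1 - v)) := by
  have hder : ∀ r : ℝ, 0 ≤ r → HasDerivAt
      (fun r : ℝ => log (1 - u * exp (-(a * r))) * log (1 - v * exp (-(b * r))))
      (kernel a b u v r + kernel b a v u r) r := fun r hr => by
    refine ((hasDerivAt_log_one_sub_mul_exp hu ha hr).mul
      (hasDerivAt_log_one_sub_mul_exp hv hb hr)).congr_deriv ?_
    simp only [kernel]
    ring
  have h := integral_Ioi_of_hasDerivAt_of_tendsto
    (hder 0 le_rfl).continuousAt.continuousWithinAt (fun r hr => hder r (le_of_lt hr))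
    ((integrableOn_kernel hu hv ha hb).add (integrableOn_kernel hv hu hb ha))
    ((tendsto_log_one_sub_mul_exp_atTop u ha).mul (tendsto_log_one_sub_mul_exp_atTop v hb))
  rw [integral_add (integrableOn_kernel hu hv ha hb) (integrableOn_kernel hv hu hb ha)] at h
  simpa [K] using h

theorem F_add_F_inv {u v : ℂ} (hu : u ∈ disk) (hv : v ∈ disk) {x : ℂ} (hx : x ∈ slitPlane) :
    F x u v + F (1 / x) v u = -(log (1 - u) * log (1 - v)) := by
  rw [one_div, F_eq_K hu hv hx, F_eq_K hv hu (inv_mem_slitPlane_of_mem hx), csqrt_inv hx, inv_inv]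
  exact K_add_K hu hv (csqrt_re_pos hx) (inv_re_pos (csqrt_re_pos hx))

theorem hasSum_pnat_of_succ {f : ℕ → ℂ} {s : ℂ} (h : HasSum (fun n => f (n + 1)) s) :
    HasSum (fun n : ℕ+ => f n) s := by
  rw [← Equiv.pnatEquivNat.symm.hasSum_iff]
  simpa [Function.comp_def] using h

theorem summable_pnat_pow {q : ℝ} (h0 : 0 ≤ q) (h1 : q < 1) : Summable fun n : ℕ+ => q ^ (n : ℕ) :=
  (summable_geometric_of_lt_one h0 h1).comp_injective PNat.coe_injective

theorem hasSum_log_pnat {p : ℂ} (hp : ‖p‖ < 1) :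
    HasSum (fun n : ℕ+ => p ^ (n : ℕ) / ((n : ℕ) : ℂ)) (-log (1 - p)) :=
  hasSum_pnat_of_succ (f := fun n => p ^ n / (n : ℂ))
    (by simpa using hasSum_taylorSeries_neg_log' hp)

theorem hasSum_geometric_pnat {q : ℂ} (hq : ‖q‖ < 1) :
    HasSum (fun n : ℕ+ => q ^ (n : ℕ)) (q / (1 - q)) :=
  hasSum_pnat_of_succ (f := fun n => q ^ n) (by
    simpa only [pow_succ', div_eq_mul_inv] using (hasSum_geometric_of_norm_lt_one hq).mul_left q)

theorem norm_pow_div_natCast_le (p : ℂ) (n : ℕ+) : ‖p ^ (n : ℕ) / ((n : ℕ) : ℂ)‖ ≤ ‖p‖ ^ (n : ℕ) := by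
  rw [norm_div, norm_pow, Complex.norm_natCast]
  exact div_le_self (by positivity) (by exact_mod_cast Nat.one_le_iff_ne_zero.2 n.ne_zero)

theorem hasSum_mul_of_summable_norm {ι κ : Type*} {f : ι → ℂ} {g : κ → ℂ} {s t : ℂ}
    (hf : HasSum f s) (hg : HasSum g t) (hf' : Summable fun n => ‖f n‖)
    (hg' : Summable fun n => ‖g n‖) : HasSum (fun m : ι × κ => f m.1 * g m.2) (s * t) :=
  hf.mul hg (summable_mul_of_summable_norm hf' hg')

theorem hasSum_log_mul_geometric {p q : ℂ} (hp : ‖p‖ < 1) (hq : ‖q‖ < 1) :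
    HasSum (fun m : ℕ+ × ℕ+ => p ^ (m.1 : ℕ) / ((m.1 : ℕ) : ℂ) * q ^ (m.2 : ℕ))
      (-log (1 - p) * (q / (1 - q))) := by
  have h := hasSum_mul_of_summable_norm (hasSum_log_pnat hp) (hasSum_geometric_pnat hq)
    (.of_nonneg_of_le (fun _ => norm_nonneg _) (norm_pow_div_natCast_le p)
      (summable_pnat_pow (norm_nonneg p) hp))
    (by simpa only [norm_pow] using summable_pnat_pow (norm_nonneg q) hq)
  exact h

/-- The product of the expansions of the two factors. -/
theorem hasSum_kernel {u v : ℂ} (hu : u ∈ disk) (hv : v ∈ disk) {a b : ℂ}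
    (ha : 0 < a.re) (hb : 0 < b.re) {r : ℝ} (hr : 0 < r) :
    HasSum (fun p : ℕ+ × ℕ+ => u ^ (p.1 : ℕ) * v ^ (p.2 : ℕ) * b / (p.1 : ℂ)
      * exp (-((a * (p.1 : ℂ) + b * (p.2 : ℂ)) * r))) (-kernel a b u v r) := by
  have h := (hasSum_log_mul_geometric (norm_mul_exp_lt_one hu ha hr)
    (norm_mul_exp_lt_one hv hb hr)).mul_right b
  have e : -log (1 - u * exp (-(a * r))) * (v * exp (-(b * r)) / (1 - v * exp (-(b * r)))) * b
      = -kernel a b u v r := by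
    rw [kernel]
    ring
  rw [← e]
  convert! h using 2 with p
  have : -((a * (p.1 : ℂ) + b * (p.2 : ℂ)) * r)
      = ((p.1 : ℕ) : ℂ) * -(a * r) + ((p.2 : ℕ) : ℂ) * -(b * r) := by ring
  rw [this, Complex.exp_add, Complex.exp_nat_mul, Complex.exp_nat_mul, mul_pow, mul_pow]
  ring

theorem hasSum_K {u v : ℂ} (hu : u ∈ disk) (hv : v ∈ disk) (hu1 : ‖u‖ < 1) (hv1 : ‖v‖ < 1) {a b : ℂ}
    (ha : 0 < a.re) (hb : 0 < b.re) :
    HasSum (fun p : ℕ+ × ℕ+ => u ^ (p.1 : ℕ) * v ^ (p.2 : ℕ) * b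
      / ((p.1 : ℂ) * (a * (p.1 : ℂ) + b * (p.2 : ℂ)))) (-K a b u v) := by
  have hc : ∀ p : ℕ+ × ℕ+, a.re + b.re ≤ (a * (p.1 : ℂ) + b * (p.2 : ℂ)).re := fun p => by
    have e1 : (1 : ℝ) ≤ (p.1 : ℕ) := by exact_mod_cast Nat.one_le_iff_ne_zero.2 p.1.ne_zero
    have e2 : (1 : ℝ) ≤ (p.2 : ℕ) := by exact_mod_cast Nat.one_le_iff_ne_zero.2 p.2.ne_zero
    simp
    nlinarith
  have hc' : ∀ p : ℕ+ × ℕ+, 0 < (a * (p.1 : ℂ) + b * (p.2 : ℂ)).re := fun p =>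
    (add_pos ha hb).trans_le (hc p)
  have hint : ∀ c : ℂ, 0 < c.re → IntegrableOn (fun r : ℝ => exp (-(c * r))) (Ioi 0) :=
    fun c hc => by
      simpa [neg_mul] using integrableOn_exp_mul_complex_Ioi (a := -c) (by simpa using hc) 0
  have h := hasSum_integral_of_summable_integral_norm (μ := volume.restrict (Ioi (0 : ℝ)))
    (F := fun (p : ℕ+ × ℕ+) (r : ℝ) => u ^ (p.1 : ℕ) * v ^ (p.2 : ℕ) * b / (p.1 : ℂ)
      * exp (-((a * (p.1 : ℂ) + b * (p.2 : ℂ)) * r)))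
    (fun p => (hint _ (hc' p)).const_mul _) ?_
  · convert! h using 1
    · ext p
      have hp0 : (p.1 : ℂ) ≠ 0 := by exact_mod_cast p.1.ne_zero
      have hi := integral_exp_mul_complex_Ioi (a := -(a * (p.1 : ℂ) + b * (p.2 : ℂ)))
        (by rw [neg_re]; linarith [hc' p]) 0
      simp only [neg_mul] at hi
      have hne := ne_zero_of_re_pos (hc' p)
      rw [integral_const_mul, hi, ofReal_zero, mul_zero, neg_zero, Complex.exp_zero,
        neg_div_neg_eq, div_mul_div_comm, mul_one]
    · rw [K, ← integral_neg]
      refine setIntegral_congr_fun measurableSet_Ioi fun r hr => ?_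
      exact (hasSum_kernel hu hv ha hb hr).tsum_eq.symm
  · refine Summable.of_nonneg_of_le (fun p => integral_nonneg fun t => norm_nonneg _) (fun p => ?_)
      ((((summable_pnat_pow (norm_nonneg u) hu1).mul_of_nonneg
        (summable_pnat_pow (norm_nonneg v) hv1) (fun _ => by positivity)
        (fun _ => by positivity))).mul_right (‖b‖ / (a.re + b.re)))
    have e1 : (1 : ℝ) ≤ (p.1 : ℕ) := by exact_mod_cast Nat.one_le_iff_ne_zero.2 p.1.ne_zero
    simp only [norm_mul, norm_exp_neg_mul, norm_div, norm_pow, Complex.norm_natCast]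
    rw [integral_const_mul]
    have hi := integral_exp_mul_Ioi (a := -(a * (p.1 : ℂ) + b * (p.2 : ℂ)).re)
        (by linarith [hc' p]) 0
    simp only [neg_mul] at hi
    rw [hi, mul_zero, neg_zero, Real.exp_zero, neg_div_neg_eq, div_mul_div_comm, mul_one, mul_div_assoc]
    refine mul_le_mul_of_nonneg_left ?_ (by positivity)
    have h0 : 0 < a.re + b.re := add_pos ha hb
    gcongr
    nlinarith [hc p]

/-! ### A primitive along the curve -/

/-- The right-hand side of the three-term equation, with `s` for the square root of `p q`. Along
`p = u e^{-x r}`, `q = v e^{-r}`, `s = √(u v) e^{-(x + 1) r / 2}` its negative is a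
primitive of the combination of integrands on the left-hand side, see `hasDerivAt_primitive`. -/
noncomputable def primitive (x p q s : ℂ) : ℂ :=
  log (1 - p) * log (1 - p * q) + Li2 p - Li2 (q / (q - 1)) + 2 * Li2 (p / (p - 1))
    - Li2 ((p - q) / (1 - q)) - (1 / (x + 1) - 1 / 2) * Li2 (p * q)
    - (Li2 ((p + -s) / (p - 1)) - Li2 ((q + -s) / (q - 1))
      + (Li2 ((p + s) / (p - 1)) - Li2 ((q + s) / (q - 1))))

theorem one_sub_sub_div {p q : ℂ} (hq : q.re < 1) : 1 - (p - q) / (1 - q) = (1 - p) / (1 - q) := by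
  have := ne_zero_of_re_pos (one_sub_re_pos hq)
  field_simp
  ring

theorem one_sub_add_div {p s : ℂ} (hp : p.re < 1) :
    1 - (p + s) / (p - 1) = (1 - -s) / (1 - p) := by
  have h := ne_zero_of_re_pos (one_sub_re_pos hp)
  have : p - 1 ≠ 0 := fun h' => h (by linear_combination -h')
  rw [show (1 - p) = -(p - 1) by ring]
  field_simp
  ring

theorem mem_cutPlane_of_eq_div {z w₁ w₂ : ℂ} (h : 1 - z = w₁ / w₂) (h₁ : 0 < w₁.re)
    (h₂ : 0 < w₂.re) : z ∈ cutPlane := by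
  rw [cutPlane, mem_ofPred_eq, h]
  exact div_mem_slitPlane_of_re_pos h₁ h₂

theorem hasDerivAt_Li2_comp {z : ℝ → ℂ} {z' w₁ w₂ : ℂ} {r : ℝ} (hz : HasDerivAt z z' r)
    (h0 : z r ≠ 0) (h : 1 - z r = w₁ / w₂) (h₁ : 0 < w₁.re) (h₂ : 0 < w₂.re) :
    HasDerivAt (fun r => Li2 (z r)) (-(log w₁ - log w₂) / z r * z') r := by
  rw [← log_div_of_re_pos h₁ h₂, ← h]
  exact HasDerivAt.comp (h₂ := Li2) r (hasDerivAt_Li2 (mem_cutPlane_of_eq_div h h₁ h₂) h0) hz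

theorem continuousAt_primitive (x : ℂ) {p q s : ℂ} (hp : p.re < 1) (hq : q.re < 1)
    (hpq : (p * q).re < 1) (hs : s.re < 1) (hs' : (-s).re < 1) :
    ContinuousAt (fun w : ℂ × ℂ × ℂ => primitive x w.1 w.2.1 w.2.2) (p, q, s) := by
  have hp1 : 1 - p ≠ 0 := ne_zero_of_re_pos (one_sub_re_pos hp)
  have hq1 : 1 - q ≠ 0 := ne_zero_of_re_pos (one_sub_re_pos hq)
  have hp1' : p - 1 ≠ 0 := fun h' => hp1 (by linear_combination -h')
  have hq1' : q - 1 ≠ 0 := fun h' => hq1 (by linear_combination -h')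
  have hL : ∀ {f : ℂ × ℂ × ℂ → ℂ}, ContinuousAt f (p, q, s) → f (p, q, s) ∈ cutPlane →
      ContinuousAt (fun w => Li2 (f w)) (p, q, s) := fun hf hm =>
    ContinuousAt.comp (g := Li2) (continuousAt_Li2 hm) hf
  have hlog : ∀ {f : ℂ × ℂ × ℂ → ℂ}, ContinuousAt f (p, q, s) → (f (p, q, s)).re < 1 →
      ContinuousAt (fun w => log (1 - f w)) (p, q, s) := fun hf hm =>
    (continuousAt_const.sub hf).clog (mem_cutPlane_of_re_lt_one hm)
  have m : ∀ {p s : ℂ}, p.re < 1 → (-s).re < 1 → (p + s) / (p - 1) ∈ cutPlane := fun hp hs =>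
    mem_cutPlane_of_eq_div (one_sub_add_div hp) (one_sub_re_pos hs) (one_sub_re_pos hp)
  have hs'' : (- -s).re < 1 := by rwa [neg_neg]
  unfold primitive
  refine ((((((ContinuousAt.mul (hlog ?_ hp) (hlog ?_ hpq)).add (hL ?_ ?_)).sub (hL ?_ ?_)).add
    (continuousAt_const.mul (hL ?_ ?_))).sub (hL ?_ ?_)).sub
    (continuousAt_const.mul (hL ?_ ?_))).sub
    (((hL ?_ ?_).sub (hL ?_ ?_)).add ((hL ?_ ?_).sub (hL ?_ ?_)))
  all_goals try exact ContinuousAt.div (by fun_prop) (by fun_prop) (by assumption)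
  · fun_prop
  · fun_prop
  · fun_prop
  · exact mem_cutPlane_of_re_lt_one hp
  · exact div_sub_one_mem_cutPlane hq
  · exact div_sub_one_mem_cutPlane hp
  · exact mem_cutPlane_of_eq_div (one_sub_sub_div hq) (one_sub_re_pos hp) (one_sub_re_pos hq)
  · fun_prop
  · exact mem_cutPlane_of_re_lt_one hpq
  · exact m hp hs''
  · exact m hq hs''
  · exact m hp hs'
  · exact m hq hs'

theorem div_mul_logDeriv_div {L w d w' d' : ℂ} (hw : w ≠ 0) (hd : d ≠ 0) :
    L / (w / d) * ((w' * d - w * d') / d ^ 2) = L * (w' / w - d' / d) := by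
  field_simp

theorem hasDerivAt_primitive {x : ℂ} (hx : x + 1 ≠ 0) {p q s : ℝ → ℂ} {r : ℝ}
    (dp : HasDerivAt p (-(x * p r)) r) (dq : HasDerivAt q (-q r) r)
    (ds : HasDerivAt s (-((x + 1) / 2 * s r)) r) (hsq : s r ^ 2 = p r * q r)
    (hp : (p r).re < 1) (hq : (q r).re < 1) (hpq : (p r * q r).re < 1) (hs : (s r).re < 1)
    (hs' : (-s r).re < 1) (hp0 : p r ≠ 0) (hq0 : q r ≠ 0) (hne : p r ≠ q r) :
    HasDerivAt (fun r => primitive x (p r) (q r) (s r))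
      (-(log (1 - p r) * (q r / (1 - q r)) - log (1 - p r * q r) * (q r / (1 - q r))
        - log (1 - p r) * ((x + 1) * (p r * q r) / (1 - p r * q r)))) r := by
  have hp1 : 1 - p r ≠ 0 := ne_zero_of_re_pos (one_sub_re_pos hp)
  have hq1 : 1 - q r ≠ 0 := ne_zero_of_re_pos (one_sub_re_pos hq)
  have hpq1 : 1 - p r * q r ≠ 0 := ne_zero_of_re_pos (one_sub_re_pos hpq)
  have hp1' : p r - 1 ≠ 0 := fun h' => hp1 (by linear_combination -h')
  have hq1' : q r - 1 ≠ 0 := fun h' => hq1 (by linear_combination -h')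
  have hs'' : (- -s r).re < 1 := by rwa [neg_neg]
  have hs0 : s r ≠ 0 := fun h => mul_ne_zero hp0 hq0 (by rw [← hsq, h]; ring)
  -- `p = ± s` would give `p² = s² = p q`
  have hps : p r + s r ≠ 0 := fun h => hne (mul_left_cancel₀ hp0 (by
    linear_combination hsq + (p r - s r) * h))
  have hps' : p r + -s r ≠ 0 := fun h => hne (mul_left_cancel₀ hp0 (by
    linear_combination hsq + (p r + s r) * h))
  have hqs : q r + s r ≠ 0 := fun h => hne (mul_right_cancel₀ hq0 (by
    linear_combination -hsq - (q r - s r) * h))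
  have hqs' : q r + -s r ≠ 0 := fun h => hne (mul_right_cancel₀ hq0 (by
    linear_combination -hsq - (q r + s r) * h))
  -- `1 - p q = (1 - s) (1 + s)`
  have hlog : log (1 - p r * q r) = log (1 - s r) + log (1 - -s r) := by
    rw [← log_mul_of_re_pos (one_sub_re_pos hs) (one_sub_re_pos hs'), ← hsq]
    ring_nf
  have hone : (0 : ℝ) < (1 : ℂ).re := by simp
  have d1 := ((dp.const_sub 1).clog_real (mem_cutPlane_of_re_lt_one hp)).mul
    (((dp.mul dq).const_sub 1).clog_real (mem_cutPlane_of_re_lt_one hpq))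
  have d2 := hasDerivAt_Li2_comp dp hp0 (div_one _).symm (one_sub_re_pos hp) hone
  have d3 := hasDerivAt_Li2_comp (dq.div (dq.sub_const 1) hq1') (div_ne_zero hq0 hq1')
    ((one_sub_div_sub_one hq1).trans (one_div _).symm) hone (one_sub_re_pos hq)
  have d4 := hasDerivAt_Li2_comp (dp.div (dp.sub_const 1) hp1') (div_ne_zero hp0 hp1')
    ((one_sub_div_sub_one hp1).trans (one_div _).symm) hone (one_sub_re_pos hp)
  have d5 := hasDerivAt_Li2_comp ((dp.sub dq).div (dq.const_sub 1) hq1)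
    (div_ne_zero (sub_ne_zero.2 hne) hq1) (one_sub_sub_div hq) (one_sub_re_pos hp)
    (one_sub_re_pos hq)
  have d6 := hasDerivAt_Li2_comp (dp.mul dq) (mul_ne_zero hp0 hq0) (div_one _).symm
    (one_sub_re_pos hpq) hone
  have d7 := hasDerivAt_Li2_comp ((dp.add ds.neg).div (dp.sub_const 1) hp1')
    (div_ne_zero hps' hp1') (one_sub_add_div hp) (one_sub_re_pos hs'') (one_sub_re_pos hp)
  have d8 := hasDerivAt_Li2_comp ((dq.add ds.neg).div (dq.sub_const 1) hq1')
    (div_ne_zero hqs' hq1') (one_sub_add_div hq) (one_sub_re_pos hs'') (one_sub_re_pos hq)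
  have d9 := hasDerivAt_Li2_comp ((dp.add ds).div (dp.sub_const 1) hp1')
    (div_ne_zero hps hp1') (one_sub_add_div hp) (one_sub_re_pos hs') (one_sub_re_pos hp)
  have d10 := hasDerivAt_Li2_comp ((dq.add ds).div (dq.sub_const 1) hq1')
    (div_ne_zero hqs hq1') (one_sub_add_div hq) (one_sub_re_pos hs') (one_sub_re_pos hq)
  refine ((((((d1.add d2).sub d3).add (d4.const_mul 2)).sub d5).sub
    (d6.const_mul (1 / (x + 1) - 1 / 2))).sub ((d7.sub d8).add (d9.sub d10))).congr_deriv ?_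
  simp only [neg_neg, log_one, Pi.add_apply, Pi.sub_apply, Pi.mul_apply, Pi.div_apply, Pi.neg_apply,
    hlog]
  generalize log (1 - p r) = A
  generalize log (1 - q r) = B
  generalize log (1 - s r) = M
  generalize log (1 - -s r) = P
  rw [div_mul_logDeriv_div hq0 hq1', div_mul_logDeriv_div hp0 hp1',
    div_mul_logDeriv_div (sub_ne_zero.2 hne) hq1, div_mul_logDeriv_div hps' hp1',
    div_mul_logDeriv_div hqs' hq1', div_mul_logDeriv_div hps hp1', div_mul_logDeriv_div hqs hq1']
  -- The curve `s² = p q` is parametrized by `p = q y²`, `s = q y`; what remains is an identity of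
  -- rational functions in `x`, `q` and `y`.
  obtain ⟨y, hy⟩ : ∃ y, y = s r / q r := ⟨_, rfl⟩
  have e1 : s r = q r * y := by rw [hy]; field_simp
  have e2 : p r = q r * y ^ 2 := by
    rw [e1] at hsq
    exact mul_right_cancel₀ hq0 (by linear_combination -hsq)
  rw [e1] at hs0 hqs hqs'
  rw [e2] at hp1 hp1' hpq1
  rw [e1, e2]
  clear * - hx hs0 hqs hqs' hp1 hp1' hpq1 hq0 hq1 hq1'
  generalize q r = q at *
  have hy0 : y ≠ 0 := right_ne_zero_of_mul hs0
  have f1 : q * y ^ 2 + q * y = q * (y * (y + 1)) := by ring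
  have f2 : q * y ^ 2 + -(q * y) = q * (y * (y - 1)) := by ring
  have f3 : q + q * y = q * (y + 1) := by ring
  have f4 : q + -(q * y) = -(q * (y - 1)) := by ring
  have f5 : q * y ^ 2 - q = q * ((y - 1) * (y + 1)) := by ring
  have y1 : y + 1 ≠ 0 := fun h => hqs (by rw [f3, h, mul_zero])
  have y2 : y - 1 ≠ 0 := fun h => hqs' (by rw [f4, h, mul_zero, neg_zero])
  rw [f1, f2, f3, f4, f5]
  have g1 : 1 - q * y ^ 2 = -(q * y ^ 2 - 1) := by ring
  have g2 : 1 - q = -(q - 1) := by ring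
  rw [g1, g2]
  generalize hk : 1 - q * y ^ 2 * q = k at *
  field_simp
  rw [← hk]
  ring

/-! ### The three-term and the six-term equation -/

theorem hasDerivAt_mul_exp (u a : ℂ) (r : ℝ) :
    HasDerivAt (fun r : ℝ => u * exp (-(a * r))) (-(a * (u * exp (-(a * r))))) r := by
  refine (((((hasDerivAt_id r).ofReal_comp).const_mul a).neg.cexp).const_mul u).congr_deriv ?_
  simp
  ring

theorem csqrt_mem_disk {w : ℂ} (hw : w ∈ disk) : csqrt w ∈ disk ∧ -csqrt w ∈ disk := by
  have h := csqrt_sq w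
  have hn : ‖csqrt w‖ ≤ 1 := by
    have h1 : ‖csqrt w‖ ^ 2 ≤ 1 := by rw [← norm_pow, h]; exact hw.2.1
    exact (sq_le_one_iff₀ (norm_nonneg _)).1 h1
  have h0 : csqrt w ≠ 0 := fun h' => hw.1 (by rw [← h, h']; ring)
  refine ⟨⟨h0, hn, fun h' => hw.2.2 (by rw [← h, h']; ring)⟩,
    neg_ne_zero.2 h0, by rwa [norm_neg], fun h' => hw.2.2 ?_⟩
  rw [← h, ← neg_sq, h']
  ring

/-- The combination of integrands is the derivative of `-primitive` along the curve. The condition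
`hne` keeps the arguments of the dilogarithms away from `0`, where the formula for the derivative
of `Li₂` is not valid. -/
theorem K_three_term {u v : ℂ} (hu : u ∈ disk) (hv : v ∈ disk) (huv : u * v ∈ disk) {x : ℝ}
    (hx : 0 < x)
    (hne : ∀ r : ℝ, 0 < r → u * exp (-((x : ℂ) * r)) ≠ v * exp (-(1 * (r : ℂ)))) :
    K x 1 u v - K (x + 1) 1 (u * v) v - K x (x + 1) u (u * v)
      = primitive x u v (csqrt (u * v)) := by
  obtain ⟨hs, hs'⟩ := csqrt_mem_disk huv
  have hs2 := csqrt_sq (u * v)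
  set s := csqrt (u * v)
  have hxre : 0 < (x : ℂ).re := by simpa using hx
  have h1re : 0 < (1 : ℂ).re := by simp
  have hx1re : 0 < ((x : ℂ) + 1).re := by simp; linarith
  have hhre : 0 < (((x : ℂ) + 1) / 2).re := by
    have : ((x : ℂ) + 1) / 2 = (((x + 1) / 2 : ℝ) : ℂ) := by push_cast; ring
    rw [this, ofReal_re]; linarith
  have hmul : ∀ r : ℝ, u * exp (-((x : ℂ) * r)) * (v * exp (-(1 * (r : ℂ))))
      = u * v * exp (-(((x : ℂ) + 1) * r)) := fun r => by
    rw [show -(((x : ℂ) + 1) * r) = -((x : ℂ) * r) + -(1 * (r : ℂ)) by ring, Complex.exp_add]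
    ring
  have hsq : ∀ r : ℝ, (s * exp (-(((x : ℂ) + 1) / 2 * r))) ^ 2
      = u * exp (-((x : ℂ) * r)) * (v * exp (-(1 * (r : ℂ)))) := fun r => by
    rw [hmul, mul_pow, hs2, ← Complex.exp_nat_mul]
    congr 2
    push_cast
    ring
  have i1 := integrableOn_kernel hu hv hxre h1re
  have i2 := integrableOn_kernel huv hv hx1re h1re
  have i3 := integrableOn_kernel hu huv hxre hx1re
  have hc := continuousAt_primitive (x : ℂ) (re_lt_one hu.2.1 hu.2.2) (re_lt_one hv.2.1 hv.2.2)
    (re_lt_one huv.2.1 huv.2.2) (re_lt_one hs.2.1 hs.2.2) (re_lt_one hs'.2.1 hs'.2.2)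
  have hc0 := continuousAt_primitive (x : ℂ) (p := 0) (q := 0) (s := 0) (by simp) (by simp)
    (by simp) (by simp) (by simp)
  have h0 : primitive (x : ℂ) 0 0 0 = 0 := by simp [primitive, Li2_zero]
  have key := integral_Ioi_of_hasDerivAt_of_tendsto (a := 0) (m := 0)
    (f := fun r : ℝ => primitive x (u * exp (-((x : ℂ) * r))) (v * exp (-(1 * (r : ℂ))))
      (s * exp (-(((x : ℂ) + 1) / 2 * r))))
    (f' := fun r => -(kernel x 1 u v r - kernel (x + 1) 1 (u * v) v r
      - kernel x (x + 1) u (u * v) r)) ?_ ?_ ((i1.sub i2).sub i3).neg ?_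
  · have e := integral_sub (i1.sub i2) i3
    simp only [Pi.sub_apply] at e
    rw [integral_neg, e, integral_sub i1 i2] at key
    simp only [ofReal_zero, mul_zero, neg_zero, Complex.exp_zero, mul_one, zero_sub] at key
    exact neg_injective key
  · refine ContinuousAt.continuousWithinAt ?_
    refine ContinuousAt.comp_of_eq
      (g := fun w : ℂ × ℂ × ℂ => primitive x w.1 w.2.1 w.2.2)
      (f := fun r : ℝ => (u * exp (-((x : ℂ) * r)), v * exp (-(1 * (r : ℂ))),
        s * exp (-(((x : ℂ) + 1) / 2 * r)))) hc (by fun_prop) ?_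
    simp
  · intro r hr
    have hr' : (0 : ℝ) ≤ r := le_of_lt hr
    have hpq : (u * exp (-((x : ℂ) * r)) * (v * exp (-(1 * (r : ℂ))))).re < 1 := by
      rw [hmul]; exact re_mul_exp_lt_one huv hx1re hr'
    have hneg : (-(s * exp (-(((x : ℂ) + 1) / 2 * r)))).re < 1 := by
      rw [← neg_mul]; exact re_mul_exp_lt_one hs' hhre hr'
    refine (hasDerivAt_primitive (x := x) (ne_zero_of_re_pos hx1re)
      (hasDerivAt_mul_exp u x r) ((hasDerivAt_mul_exp v 1 r).congr_deriv (by ring))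
      (hasDerivAt_mul_exp s ((x + 1) / 2) r) (hsq r) (re_mul_exp_lt_one hu hxre hr')
      (re_mul_exp_lt_one hv h1re hr') hpq (re_mul_exp_lt_one hs hhre hr') hneg
      (mul_ne_zero hu.1 (Complex.exp_ne_zero _)) (mul_ne_zero hv.1 (Complex.exp_ne_zero _))
      (hne r hr)).congr_deriv ?_
    rw [hmul]
    simp only [kernel]
    ring
  · have ht := (tendsto_mul_exp_atTop u hxre).prodMk_nhds
      ((tendsto_mul_exp_atTop v h1re).prodMk_nhds (tendsto_mul_exp_atTop s hhre))
    have := hc0.tendsto.comp ht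
    simpa only [h0, Function.comp_def] using this

theorem add_one_mem_slitPlane {x : ℂ} (hx : x ∈ slitPlane) : x + 1 ∈ slitPlane := by
  rw [add_comm]; exact one_add_mem_slitPlane hx

theorem div_add_one_mem_slitPlane {x : ℂ} (hx : x ∈ slitPlane) : x / (x + 1) ∈ slitPlane := by
  have h1 := slitPlane_ne_zero (add_one_mem_slitPlane hx)
  have h0 := slitPlane_ne_zero hx
  have e : x / (x + 1) = (1 + x⁻¹)⁻¹ := by
    have : 1 + x⁻¹ = (x + 1) / x := by field_simp
    rw [this, inv_div]
  rw [e]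
  exact inv_mem_slitPlane_of_mem (one_add_mem_slitPlane (inv_mem_slitPlane_of_mem hx))

theorem F_three_term {u v : ℂ} (hu : u ∈ disk) (hv : v ∈ disk) (huv : u * v ∈ disk) {x : ℂ}
    (hx : x ∈ slitPlane) :
    F x u v - F (x + 1) (u * v) v - F (x / (x + 1)) u (u * v)
      = primitive x u v (csqrt (u * v)) := by
  have d1 := (isContinuation_F hu hv).1
  have d2 := (isContinuation_F huv hv).1.comp (f := fun x : ℂ => x + 1) (s := slitPlane)
    (by fun_prop) fun x hx => add_one_mem_slitPlane hx
  have d3 := (isContinuation_F hu huv).1.comp (f := fun x : ℂ => x / (x + 1)) (s := slitPlane)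
    (DifferentiableOn.div (by fun_prop) (by fun_prop)
      fun x hx => slitPlane_ne_zero (add_one_mem_slitPlane hx))
    fun x hx => div_add_one_mem_slitPlane hx
  have d4 : DifferentiableOn ℂ (fun x => primitive x u v (csqrt (u * v))) slitPlane := by
    have : DifferentiableOn ℂ (fun x : ℂ => 1 / (x + 1)) slitPlane :=
      DifferentiableOn.div (by fun_prop) (by fun_prop)
        fun x hx => slitPlane_ne_zero (add_one_mem_slitPlane hx)
    unfold primitive
    exact (((this.sub_const _).mul_const _).const_sub _).sub_const _
  have real : ∀ x : ℝ, 0 < x →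
      (∀ r : ℝ, 0 < r → u * exp (-((x : ℂ) * r)) ≠ v * exp (-(1 * (r : ℂ)))) →
      F x u v - F ((x : ℂ) + 1) (u * v) v - F ((x : ℂ) / (x + 1)) u (u * v)
        = primitive x u v (csqrt (u * v)) := fun x hx hne => by
    have hx1 : (0 : ℝ) < x + 1 := by linarith
    have hx1c : (x : ℂ) + 1 ≠ 0 := by exact_mod_cast hx1.ne'
    have hdiv : (x : ℂ) / (x + 1) = ((x / (x + 1) : ℝ) : ℂ) := by push_cast; rfl
    rw [F_eq_K_of_re_pos hu hv (by simpa using hx),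
      F_eq_K_of_re_pos huv hv (by simp; linarith),
      F_eq_K_of_re_pos hu huv (by rw [hdiv, ofReal_re]; positivity),
      ← K_smul ((x : ℂ) / (x + 1)) 1 u (u * v) hx1]
    push_cast
    rw [mul_div_cancel₀ _ hx1c, mul_one]
    exact K_three_term hu hv huv hx hne
  -- The curve avoids the diagonal when the smaller of `u`, `v` also decays faster.
  have hnorm : ∀ {x r : ℝ}, u * exp (-((x : ℂ) * r)) = v * exp (-(1 * (r : ℂ))) →
      ‖u‖ * Real.exp (-(x * r)) = ‖v‖ * Real.exp (-(1 * r)) := fun h => by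
    have := congrArg norm h
    simpa only [norm_mul, norm_exp_neg_mul, ofReal_re, one_re] using this
  have hu0 := norm_pos_iff.2 hu.1
  have hv0 := norm_pos_iff.2 hv.1
  rcases le_total ‖u‖ ‖v‖ with h | h
  · refine eqOn_of_eq_on_reals isOpen_slitPlane isPreconnected_slitPlane ((d1.sub d2).sub d3) d4
      (α := 1) (β := 2) (by norm_num) (fun t ht => mem_slitPlane_of_re_pos ?_) (fun t ht => ?_) hx
    · rw [ofReal_re]; linarith [ht.1]
    · refine real t (by linarith [ht.1]) fun r hr heq => ?_
      have h1 : Real.exp (-(t * r)) < Real.exp (-(1 * r)) :=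
        Real.exp_lt_exp.2 (by nlinarith [ht.1])
      exact absurd (hnorm heq) (mul_lt_mul' h h1 (Real.exp_pos _).le hv0).ne
  · refine eqOn_of_eq_on_reals isOpen_slitPlane isPreconnected_slitPlane ((d1.sub d2).sub d3) d4
      (α := 0) (β := 1) (by norm_num) (fun t ht => mem_slitPlane_of_re_pos ?_) (fun t ht => ?_) hx
    · rw [ofReal_re]; exact ht.1
    · refine real t ht.1 fun r hr heq => ?_
      have h1 : Real.exp (-(1 * r)) < Real.exp (-(t * r)) :=
        Real.exp_lt_exp.2 (by nlinarith [ht.2])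
      exact absurd (hnorm heq) (mul_lt_mul' h h1 (Real.exp_pos _).le hu0).ne'

theorem sum_expPi (f : ℂ → ℂ) : ∑ j ∈ Finset.Icc 1 2, f (expPi j) = f (-1) + f 1 := by
  have h1 : expPi 1 = -1 := by simp [expPi]
  have h2 : expPi 2 = 1 := by
    rw [expPi, ← Complex.exp_two_pi_mul_I]
    congr 1
    push_cast
    ring
  rw [show Finset.Icc 1 2 = {1, 2} from rfl, Finset.sum_pair (by norm_num), h1, h2]

theorem circle_subset_disk {u : ℂ} (hu : u ∈ circle) : u ∈ disk :=
  ⟨fun h => by simpa [h] using hu.1, hu.1.le, hu.2⟩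

theorem inv_mem_circle {u : ℂ} (hu : u ∈ circle) : u⁻¹ ∈ circle :=
  ⟨by rw [norm_inv, hu.1, inv_one], fun h => hu.2 (inv_eq_one.1 h)⟩

theorem neg_mem_slitPlane_of_mem_circle {u : ℂ} (hu : u ∈ circle) : -u ∈ slitPlane := by
  by_cases him : u.im = 0
  · have h1 := re_lt_one hu.1.le hu.2
    have h2 := Complex.sq_norm u
    rw [hu.1, normSq_apply, him] at h2
    refine Or.inl ?_
    rw [neg_re]
    nlinarith
  · exact Or.inr (by simpa using him)

/-- The reflection formula at `u / (u - 1)`, which lies on the line `Re z = 1 / 2`. -/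
theorem Li2_div_sub_one_add_inv {u : ℂ} (hu : u ∈ circle) :
    Li2 (u / (u - 1)) + Li2 (u⁻¹ / (u⁻¹ - 1))
      = (Real.pi : ℂ) ^ 2 / 6 + log (u / (u - 1)) * log (1 - u) := by
  have hre := re_lt_one hu.1.le hu.2
  have hre' := re_lt_one (inv_mem_circle hu).1.le (inv_mem_circle hu).2
  have hne := ne_zero_of_re_pos (one_sub_re_pos hre)
  have hne' := ne_zero_of_re_pos (one_sub_re_pos hre')
  have h0 := (circle_subset_disk hu).1
  have hu1 : u - 1 ≠ 0 := sub_ne_zero.2 hu.2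
  have e1 : u / (u - 1) = (1 - u⁻¹)⁻¹ := by
    rw [show 1 - u⁻¹ = (u - 1) / u by field_simp, inv_div]
  have e2 : u⁻¹ / (u⁻¹ - 1) = 1 - u / (u - 1) := by
    rw [one_sub_div_sub_one hne, show u⁻¹ - 1 = (1 - u) / u by field_simp]
    field_simp
  rw [e2, Li2_add_Li2_one_sub, log_one_sub_div_sub_one hre]
  · ring
  · rw [e1]; exact inv_re_pos (one_sub_re_pos hre')
  · have := inv_re_pos (one_sub_re_pos hre)
    rw [← one_sub_div_sub_one hne, sub_re, one_re] at this
    linarith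

/-- A sum over both signs does not depend on the choice of the square root. -/
theorem add_neg_eq_of_sq_eq {w w' : ℂ} (h : w ^ 2 = w' ^ 2) (f : ℂ → ℂ) :
    f (-w) + f w = f (-w') + f w' := by
  rcases sq_eq_sq_iff_eq_or_eq_neg.1 h with rfl | rfl
  · rfl
  · rw [neg_neg, add_comm]

end HZN

theorem theorem2p2 :
    -- the function is well defined: the integral converges, its continuation exists, and inside
    -- the unit disc it is given by the double series
    (∀ u ∈ HZN.disk, ∀ v ∈ HZN.disk,
      (∀ x : ℂ, 0 < x.re →
        IntervalIntegrable (HZN.integrand x u v) MeasureTheory.volume 0 1) ∧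
      HZN.IsContinuation u v (fun x => HZN.F x u v) ∧
      (‖u‖ < 1 → ‖v‖ < 1 → ∀ x ∈ Complex.slitPlane,
        HasSum (fun p : ℕ+ × ℕ+ =>
            u ^ (p.1 : ℕ) * v ^ (p.2 : ℕ) / ((p.1 : ℂ) * ((p.1 : ℂ) * x + (p.2 : ℂ))))
          (-HZN.F x u v))) ∧
    -- the two-term equation
    (∀ x ∈ Complex.slitPlane, ∀ u ∈ HZN.disk, ∀ v ∈ HZN.disk,
      HZN.F x u v + HZN.F (1 / x) v u = -(Complex.log (1 - u) * Complex.log (1 - v))) ∧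
    -- the three-term equation
    (∀ x ∈ Complex.slitPlane, ∀ u ∈ HZN.disk, ∀ v ∈ HZN.disk, u * v ∈ HZN.disk →
      HZN.F x u v - HZN.F (x + 1) (u * v) v - HZN.F (x / (x + 1)) u (u * v) =
        Complex.log (1 - u) * Complex.log (1 - u * v) + HZN.Li2 u - HZN.Li2 (v / (v - 1))
          + 2 * HZN.Li2 (u / (u - 1)) - HZN.Li2 ((u - v) / (1 - v))
          - (1 / (x + 1) - 1 / 2) * HZN.Li2 (u * v)
          - ∑ j ∈ Finset.Icc 1 2,
              (HZN.Li2 ((u + HZN.csqrt (u * v) * HZN.expPi j) / (u - 1))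
                - HZN.Li2 ((v + HZN.csqrt (u * v) * HZN.expPi j) / (v - 1)))) ∧
    -- the six-term equation
    (∀ x ∈ Complex.slitPlane, ∀ u ∈ HZN.circle, ∀ v ∈ HZN.circle, u * v ≠ 1 →
      HZN.F x u v + HZN.F x u⁻¹ v⁻¹
          - HZN.F (x + 1) (u * v) v - HZN.F (x + 1) (u * v)⁻¹ v⁻¹
          - HZN.F (x / (x + 1)) u (u * v) - HZN.F (x / (x + 1)) u⁻¹ (u * v)⁻¹ =
        Complex.log (1 - u) * Complex.log (1 - u * v)
          + Complex.log (1 - u⁻¹) * Complex.log (1 - (u * v)⁻¹)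
          + 2 * Complex.log (u / (u - 1)) * Complex.log (1 - u)
          - 1 / 2 * Complex.log (-u) ^ 2
          - Complex.log (v / (v - 1)) * Complex.log (1 - v)
          + (1 / (x + 1) - 1 / 2)
              * (1 / 2 * Complex.log (-(u * v)) ^ 2 + (Real.pi : ℂ) ^ 2 / 6)
          - HZN.Li2 ((u - v) / (1 - v)) - HZN.Li2 ((u - v) / (u * (1 - v)))
          - ∑ j ∈ Finset.Icc 1 2,
              (HZN.Li2 ((u + HZN.csqrt (u * v) * HZN.expPi j) / (u - 1))
                - HZN.Li2 ((v + HZN.csqrt (u * v) * HZN.expPi j) / (v - 1))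
                + HZN.Li2 ((1 + HZN.csqrt (u * v⁻¹) * HZN.expPi j) / (1 - u))
                - HZN.Li2 ((1 + HZN.csqrt (v * u⁻¹) * HZN.expPi j) / (1 - v)))) := by
  refine ⟨fun u hu v hv => ⟨fun x hx => HZN.intervalIntegrable_integrand hu hv hx,
    HZN.isContinuation_F hu hv, fun hu1 hv1 x hx => ?_⟩, fun x hx u hu v hv =>
    HZN.F_add_F_inv hu hv hx, fun x hx u hu v hv huv => ?_, fun x hx u hu v hv huv => ?_⟩
  · have hs := HZN.csqrt_re_pos hx
    have hs0 := Complex.ne_zero_of_re_pos hs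
    have h := HZN.hasSum_K hu hv hu1 hv1 hs (HZN.inv_re_pos hs)
    rw [← HZN.F_eq_K hu hv hx] at h
    have hsq := HZN.csqrt_sq x
    convert! h using 2 with p
    generalize HZN.csqrt x = s at *
    subst hsq
    rw [show s * (p.1 : ℂ) + s⁻¹ * (p.2 : ℂ) = s⁻¹ * ((p.1 : ℂ) * s ^ 2 + (p.2 : ℂ)) by field_simp,
      mul_left_comm _ s⁻¹, mul_comm _ s⁻¹, mul_div_mul_left _ _ (inv_ne_zero hs0)]
  · rw [HZN.F_three_term hu hv huv hx, HZN.sum_expPi fun c =>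
      HZN.Li2 ((u + HZN.csqrt (u * v) * c) / (u - 1)) - HZN.Li2 ((v + HZN.csqrt (u * v) * c) / (v - 1))]
    simp only [HZN.primitive, mul_neg, mul_one]
  · have hu' := HZN.inv_mem_circle hu
    have hv' := HZN.inv_mem_circle hv
    have huvc : u * v ∈ HZN.circle := ⟨by rw [norm_mul, hu.1, hv.1, mul_one], huv⟩
    have huvc' := HZN.inv_mem_circle huvc
    have h1 := HZN.F_three_term (HZN.circle_subset_disk hu) (HZN.circle_subset_disk hv)
      (HZN.circle_subset_disk huvc) hx
    have h2 := HZN.F_three_term (HZN.circle_subset_disk hu') (HZN.circle_subset_disk hv')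
      (by rw [← mul_inv]; exact HZN.circle_subset_disk huvc') hx
    have i1 := HZN.Li2_add_Li2_inv (HZN.neg_mem_slitPlane_of_mem_circle hu)
    have i2 := HZN.Li2_add_Li2_inv (HZN.neg_mem_slitPlane_of_mem_circle huvc)
    have r1 := HZN.Li2_div_sub_one_add_inv hu
    have r2 := HZN.Li2_div_sub_one_add_inv hv
    have hu0 := (HZN.circle_subset_disk hu).1
    have hv0 := (HZN.circle_subset_disk hv).1
    have hu1 : u - 1 ≠ 0 := sub_ne_zero.2 hu.2
    have hv1 : v - 1 ≠ 0 := sub_ne_zero.2 hv.2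
    have hu1' : 1 - u ≠ 0 := sub_ne_zero.2 hu.2.symm
    have hv1' : 1 - v ≠ 0 := sub_ne_zero.2 hv.2.symm
    have hinv : ∀ {z : ℂ}, z ≠ 0 → 1 - z ≠ 0 → ∀ t : ℂ,
        (z⁻¹ + t) / (z⁻¹ - 1) = (1 + z * t) / (1 - z) := fun hz hz1 t => by
      rw [show (_ : ℂ)⁻¹ - 1 = (1 - _) / _ from by field_simp]
      field_simp
    have e1 : (u⁻¹ - v⁻¹) / (1 - v⁻¹) = (u - v) / (u * (1 - v)) := by
      rw [show 1 - v⁻¹ = -(1 - v) / v by field_simp; ring]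
      field_simp
      ring
    -- `u √(1 / (u v))` and `√(u / v)` have the same square, so they agree up to sign.
    have ht := HZN.csqrt_sq (u⁻¹ * v⁻¹)
    have g1 := HZN.add_neg_eq_of_sq_eq (w := u * HZN.csqrt (u⁻¹ * v⁻¹)) (w' := HZN.csqrt (u * v⁻¹))
      (by rw [mul_pow, ht, HZN.csqrt_sq]; field_simp) fun w => HZN.Li2 ((1 + w) / (1 - u))
    have g2 := HZN.add_neg_eq_of_sq_eq (w := v * HZN.csqrt (u⁻¹ * v⁻¹)) (w' := HZN.csqrt (v * u⁻¹))
      (by rw [mul_pow, ht, HZN.csqrt_sq]; field_simp) fun w => HZN.Li2 ((1 + w) / (1 - v))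
    rw [HZN.sum_expPi fun c => HZN.Li2 ((u + HZN.csqrt (u * v) * c) / (u - 1))
      - HZN.Li2 ((v + HZN.csqrt (u * v) * c) / (v - 1))
      + HZN.Li2 ((1 + HZN.csqrt (u * v⁻¹) * c) / (1 - u))
      - HZN.Li2 ((1 + HZN.csqrt (v * u⁻¹) * c) / (1 - v))]
    simp only [HZN.primitive, hinv hu0 hu1', hinv hv0 hv1', e1, mul_neg, mul_one] at h1 h2 g1 g2 ⊢
    rw [← mul_inv u v] at h2 g1 g2
    linear_combination h1 + h2 + i1 + 2 * r1 - r2 - (1 / (x + 1) - 1 / 2) * i2 - g1 + g2
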